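/- **Setting.** Let $m_Q,m_r,L_r,L_c,g>0$, $I_r=\tfrac23 m_rL_r$, and write $\hat a b=a\times b$ for $a,b\in\mathbb R^3$. The reduced (inelastic-cable) model of two quadrotors carrying a rod has states $x_r,v_r\in\mathbb R^3$, $q_r,q_1,q_2\in S^2$ and $\omega_r\perp q_r$, $\omega_j\perp q_j$, and for $j=1,2$ it reads $$\dot x_r=v_r,\quad m_r(\dot v_r+ge_3)=\mu_1+\mu_2,\quad \dot q_r=\omega_r\times q_r,\quad I_r\dot\omega_r=q_r\times(\mu_2-\mu_1),$$ $$\dot q_j=\omega_j\times q_j,\quad m_QL_c\dot\omega_j=m_Q\,q_j\times(\ddot x_r+(-1)^jL_r\ddot q_r+ge_3)-q_j\times u_j .$$ **Reference.** Let $\tilde x_r:\mathbb R\to\mathbb R^3$ and $\tilde q_r:\mathbb R\to S^2$ be smooth, $\tilde v_r=\dot{\tilde x}_r$, $\tilde\omega_r=\tilde q_r\times\dot{\tilde q}_r$. Assume that on $[0,\infty)$ the derivatives of $\tilde x_r$ of orders $2,3$ and of $\tilde q_r$ of orders $1,2,3$ are bounded, and that the nominal forces $\tfrac12\big[m_r(\dot{\tilde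 v}_r+ge_3)-(-1)^jI_r\,\tilde q_r\times\dot{\tilde\omega}_r\big]$, $j=1,2$, are bounded away from $0$ in norm (so that the desired cable attitudes below are well defined near the reference, with bounded angular velocity). **Errors.** $e_{x_r}=x_r-\tilde x_r$, $e_{v_r}=v_r-\tilde v_r$ and, for $i\in\{r,1,2\}$, $e_{q_i}=\tilde q_i\times q_i$, $e_{\omega_i}=\omega_i+\hat q_i^2\tilde\omega_i$, $\Psi_i=1-\tilde q_i^Tq_i$. **Controls.** Fix a sign $\sigma\in\{1,-1\}$. For positive gains $k_{x_r},k_{v_r},k_{q_r},k_{\omega_r},k_{q_j},k_{\omega_j}$ define $\tilde\mu_1,\tilde\mu_2$ by $$\tilde\mu_1+\tilde\mu_2=m_r(\dot{\tilde v}_r+ge_3-k_{v_r}e_{v_r}-k_{x_r}e_{x_r}),$$ $$\tilde\mu_2-\tilde\mu_1=I_r\big[-\hat q_r\dot{\tilde\omega}_r+\sigma\big((q_r^T\tilde\omega_r)\hat q_r^2\tilde\omega_r-(q_r^T\tilde\omega_r)e_{\omega_r}\big)+k_{\omega_r}\hat q_re_{\omega_r}+k_{q_r}\hat q_re_{q_r}\big],$$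 and put $\mu_j=(I+\hat q_j^2)\tilde\mu_j$, $\tilde q_j=-\tilde\mu_j/\|\tilde\mu_j\|$, $\tilde\omega_j=\tilde q_j\times\dot{\tilde q}_j$, where dots on $\tilde q_j,\tilde\omega_j$ are time derivatives along the closed-loop motion (they are functions of time and state). Let $u_j=u_j^{\parallel}+u_j^{\perp}$ with $w_j=\ddot x_r+(-1)^jL_r\ddot q_r+ge_3$ and $$u_j^{\parallel}=\mu_j+m_Q\big[(q_j^Tw_j)q_j+L_c\|\omega_j\|^2q_j\big],$$ $$u_j^{\perp}=-m_Q\hat q_j^2\big[w_j+L_c\hat q_j\dot{\tilde\omega}_j-L_c(q_j^T\tilde\omega_j)\omega_j\big]-m_QL_c\hat q_j\big[k_{q_j}e_{q_j}+k_{\omega_j}e_{\omega_j}\big].$$ **Theorem.** For $\psi_1,\psi_2\in(0,1)$ let $\alpha=2\max\{\alpha_1,\alpha_2\}$ with $\alpha_j=\sqrt{\psi_j(2-\psi_j)}$ (the bound for $\|e_{q_j}\|$ on $\Psi_j\le\psi_j$). There is $\alpha_0>0$ such that for all $\psi_1,\psi_2\in(0,1)$ with $\alpha\le\alpha_0$ there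 are positive gains $k_{x_r},k_{v_r},k_{q_r},k_{\omega_r},k_{q_1},k_{\omega_1},k_{q_2},k_{\omega_2}$ for which the zero equilibrium of the tracking errors $z=(e_{x_r},e_{v_r},e_{q_r},e_{\omega_r},e_{q_1},e_{\omega_1},e_{q_2},e_{\omega_2})$ of the closed loop is exponentially stable, with all cable attitude errors $\Psi_j\le\psi_j$ admitted. That is, there are $\delta,C,\lambda>0$ such that for every $t_0\ge0$ and every initial state at time $t_0$ with $$\|e_{x_r}\|,\ \|e_{v_r}\|,\ \Psi_r,\ \|e_{\omega_r}\|,\ \|e_{\omega_1}\|,\ \|e_{\omega_2}\|\le\delta,\qquad \Psi_1\le\psi_1,\ \Psi_2\le\psi_2,$$ the closed loop has a solution on $[t_0,\infty)$, and every solution on an interval $[t_0,T)$ with this initial state satisfies $$\|z(t)\|\le C\,\|z(t_0)\|\,e^{-\lambda(t-t_0)}\quad\text{and}\quad \Psi_r(t),\Psi_1(t),\Psi_2(t)<1\qquad(t_0\le t<T).$$ -/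

import Mathlib

open scoped ContDiff

namespace RodTransport

noncomputable section

/-- Euclidean three-space. -/
abbrev V : Type := EuclideanSpace ℝ (Fin 3)

/-- The hat map, applied: `hat a b = a × b`. -/
def hat (a b : V) : V := WithLp.toLp 2 (crossProduct (WithLp.ofLp a) (WithLp.ofLp b))

/-- The upward vertical unit vector. -/
def e3 : V := !₂[0, 0, 1]

/-- The sign `(-1)^j` of cable `j ∈ {1, 2}`; cables `1, 2` are indexed by `0, 1 : Fin 2`. -/
def sgn (j : Fin 2) : ℝ := (-1) ^ ((j : ℕ) + 1)

/-- Attitude error vector `q̃ × q`. -/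
def attErr (qd q : V) : V := hat qd q

/-- Angular velocity error `ω + q̂² ω̃`. -/
def angErr (q w wd : V) : V := w + hat q (hat q wd)

/-- Configuration error function `Ψ = 1 - q̃ᵀ q`. -/
def Psi (qd q : V) : ℝ := 1 - inner ℝ qd q

/-- Physical parameters: mass of each quadrotor, mass of the rod, half length of the rod,
length of the cables, gravitational acceleration. -/
structure Params where
  mQ : ℝ
  mr : ℝ
  Lr : ℝ
  Lc : ℝ
  g : ℝ
  mQ_pos : 0 < mQ
  mr_pos : 0 < mr
  Lr_pos : 0 < Lr
  Lc_pos : 0 < Lc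
  g_pos : 0 < g

/-- `I_r = (2/3) m_r L_r`. -/
def Params.Ir (P : Params) : ℝ := 2 / 3 * P.mr * P.Lr

/-- The desired position and attitude of the rod as functions of time. -/
structure Reference where
  x : ℝ → V
  q : ℝ → V

/-- Desired velocity. -/
def Reference.v (R : Reference) (t : ℝ) : V := deriv R.x t

/-- Desired acceleration. -/
def Reference.a (R : Reference) (t : ℝ) : V := deriv R.v t

/-- Desired angular velocity: the vector with `q̃' = ω̃ × q̃` and `ω̃ᵀ q̃ = 0`. -/
def Reference.w (R : Reference) (t : ℝ) : V := hat (R.q t) (deriv R.q t)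

/-- Desired angular acceleration. -/
def Reference.wdot (R : Reference) (t : ℝ) : V := deriv R.w t

/-- The value of the desired cable force `μ̃_j` when the rod tracks its reference exactly
(it does not depend on the gains). -/
def nominalForce (P : Params) (R : Reference) (j : Fin 2) (t : ℝ) : V :=
  (1 / 2 : ℝ) • (P.mr • (R.a t + P.g • e3) - sgn j • P.Ir • hat (R.q t) (R.wdot t))

/-- Standing assumptions on the reference: it is smooth, `q̃_r` takes values in the unit sphere,
the derivatives entering the desired controls and the desired cable motions are bounded, and the
nominal cable forces stay away from zero, so that the desired cable attitudes `-μ̃_j / ‖μ̃_j‖` are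
well defined with bounded angular velocity along the reference. -/
structure Reference.Admissible (P : Params) (R : Reference) : Prop where
  smooth_x : ContDiff ℝ ∞ R.x
  smooth_q : ContDiff ℝ ∞ R.q
  unit_q : ∀ t, ‖R.q t‖ = 1
  bounded_x : ∃ B : ℝ, ∀ t, 0 ≤ t → ∀ k ∈ Finset.Icc 2 3, ‖iteratedDeriv k R.x t‖ ≤ B
  bounded_q : ∃ B : ℝ, ∀ t, 0 ≤ t → ∀ k ∈ Finset.Icc 1 3, ‖iteratedDeriv k R.q t‖ ≤ B
  nominal_ne_zero : ∃ c : ℝ, 0 < c ∧ ∀ t, 0 ≤ t → ∀ j, c ≤ ‖nominalForce P R j t‖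

/-- Control gains. -/
structure Gains where
  kx : ℝ
  kv : ℝ
  kqr : ℝ
  kwr : ℝ
  kq : Fin 2 → ℝ
  kw : Fin 2 → ℝ

/-- All gains are positive. -/
def Gains.Positive (K : Gains) : Prop :=
  0 < K.kx ∧ 0 < K.kv ∧ 0 < K.kqr ∧ 0 < K.kwr ∧ (∀ j, 0 < K.kq j) ∧ (∀ j, 0 < K.kw j)

/-- The state `((x_r, v_r, q_r, ω_r), (q_j, ω_j)_j)`, in the ambient vector space. -/
abbrev State : Type := (V × V × V × V) × (Fin 2 → V × V)

namespace State

/-- Position of the rod. -/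
def xr (s : State) : V := s.1.1
/-- Velocity of the rod. -/
def vr (s : State) : V := s.1.2.1
/-- Attitude of the rod. -/
def qr (s : State) : V := s.1.2.2.1
/-- Angular velocity of the rod. -/
def wr (s : State) : V := s.1.2.2.2
/-- Attitude of cable `j`. -/
def q (s : State) (j : Fin 2) : V := (s.2 j).1
/-- Angular velocity of cable `j`. -/
def w (s : State) (j : Fin 2) : V := (s.2 j).2

end State

/-- The phase space: attitudes are unit vectors and angular velocities are orthogonal to them. -/
structure OnPhaseSpace (s : State) : Prop where
  unit_qr : ‖State.qr s‖ = 1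
  orth_wr : inner ℝ (State.qr s) (State.wr s) = 0
  unit_q : ∀ j, ‖State.q s j‖ = 1
  orth_w : ∀ j, inner ℝ (State.q s j) (State.w s j) = 0

/-! ### The reduced control system -/

/-- `v̇_r`, from `m_r (v̇_r + g e₃) = μ₁ + μ₂`. -/
def rodAcc (P : Params) (mu : Fin 2 → V) : V := (1 / P.mr) • (mu 0 + mu 1) - P.g • e3

/-- `ω̇_r`, from `(2/3) m_r L_r ω̇_r = q_r × (μ₂ - μ₁)`. -/
def rodAngAcc (P : Params) (mu : Fin 2 → V) (s : State) : V :=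
  (1 / P.Ir) • hat (State.qr s) (mu 1 - mu 0)

/-- `q̈_r`, from differentiating `q̇_r = ω_r × q_r`. -/
def rodAttAcc (P : Params) (mu : Fin 2 → V) (s : State) : V :=
  hat (rodAngAcc P mu s) (State.qr s) + hat (State.wr s) (hat (State.wr s) (State.qr s))

/-- The vector `ẍ_r + (-1)^j L_r q̈_r + g e₃`. -/
def endAcc (P : Params) (mu : Fin 2 → V) (s : State) (j : Fin 2) : V :=
  rodAcc P mu + (sgn j * P.Lr) • rodAttAcc P mu s + P.g • e3

/-- The right-hand side of the reduced control system
`ẋ_r = v_r`, `m_r (v̇_r + g e₃) = μ₁ + μ₂`, `q̇_r = ω_r × q_r`,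
`(2/3) m_r L_r ω̇_r = q_r × (μ₂ - μ₁)`, `q̇_j = ω_j × q_j`,
`m_Q L_c ω̇_j = m_Q q_j × (ẍ_r + (-1)^j L_r q̈_r + g e₃) - q_j × u_j`. -/
def reducedField (P : Params) (mu u : Fin 2 → V) (s : State) : State :=
  ((State.vr s, rodAcc P mu, hat (State.wr s) (State.qr s), rodAngAcc P mu s),
    fun j => (hat (State.w s j) (State.q s j),
      (1 / (P.mQ * P.Lc)) •
        (P.mQ • hat (State.q s j) (endAcc P mu s j) - hat (State.q s j) (u j))))

/-! ### Rod errors and the controls `μ_j` -/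

section Control

variable (sigma : ℝ) (P : Params) (R : Reference) (K : Gains)

/-- Position error `e_{x_r}`. -/
def ex (t : ℝ) (s : State) : V := State.xr s - R.x t

/-- Velocity error `e_{v_r}`. -/
def ev (t : ℝ) (s : State) : V := State.vr s - R.v t

/-- Rod attitude error `e_{q_r}`. -/
def eqr (t : ℝ) (s : State) : V := attErr (R.q t) (State.qr s)

/-- Rod angular velocity error `e_{ω_r}`. -/
def ewr (t : ℝ) (s : State) : V := angErr (State.qr s) (State.wr s) (R.w t)

/-- The prescribed value of `μ̃₁ + μ̃₂`. -/
def muSum (t : ℝ) (s : State) : V :=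
  P.mr • (R.a t + P.g • e3 - K.kv • ev R t s - K.kx • ex R t s)

/-- The prescribed value of `μ̃₂ - μ̃₁`. Here `sigma = 1` gives
`+ (q_rᵀ ω̃_r) q̂_r² ω̃_r - (q_rᵀ ω̃_r) e_{ω_r}`, and `sigma = -1` gives the opposite sign of
these two terms, which is the one that cancels the drift of the error dynamics exactly. -/
def muDiff (t : ℝ) (s : State) : V :=
  P.Ir • (-hat (State.qr s) (R.wdot t)
    + sigma • (inner ℝ (State.qr s) (R.w t) • hat (State.qr s) (hat (State.qr s) (R.w t))
        - inner ℝ (State.qr s) (R.w t) • ewr R t s)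
    + K.kwr • hat (State.qr s) (ewr R t s)
    + K.kqr • hat (State.qr s) (eqr R t s))

/-- The desired control `μ̃_j`. -/
def muDes (j : Fin 2) (t : ℝ) (s : State) : V :=
  (1 / 2 : ℝ) • (muSum P R K t s + sgn j • muDiff sigma P R K t s)

/-- The applied control `μ_j = (I + q̂_j²) μ̃_j`, the component of `μ̃_j` along `q_j`. -/
def mu (t : ℝ) (s : State) (j : Fin 2) : V :=
  muDes sigma P R K j t s + hat (State.q s j) (hat (State.q s j) (muDes sigma P R K j t s))

/-! ### Desired cable motion, cable errors and the thrusts `u_j` -/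

/-- The desired cable attitude `q̃_j = -μ̃_j / ‖μ̃_j‖`. -/
def qDes (j : Fin 2) (t : ℝ) (s : State) : V :=
  -(‖muDes sigma P R K j t s‖⁻¹ • muDes sigma P R K j t s)

/-- The total time derivative, along the motion of the controlled system, of a function `f` of time
and state that does not depend on `ω₁, ω₂`. For such `f` the thrusts do not matter, since they enter
only the equations for `ω̇₁, ω̇₂`; they are set to zero here. It is only applied to such `f`. -/
def timeDeriv (f : ℝ → State → V) (t : ℝ) (s : State) : V :=
  fderiv ℝ (fun p : ℝ × State => f p.1 p.2) (t, s)
    (1, reducedField P (mu sigma P R K t s) 0 s)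

/-- The desired angular velocity of cable `j`: the vector with `q̃_j' = ω̃_j × q̃_j` and
`ω̃_jᵀ q̃_j = 0`. It depends on `x_r, v_r, q_r, ω_r, q₁, q₂` only. -/
def wDes (j : Fin 2) (t : ℝ) (s : State) : V :=
  hat (qDes sigma P R K j t s) (timeDeriv sigma P R K (qDes sigma P R K j) t s)

/-- The time derivative of `ω̃_j`. -/
def wDesDot (j : Fin 2) (t : ℝ) (s : State) : V :=
  timeDeriv sigma P R K (wDes sigma P R K j) t s

/-- Cable attitude error `e_{q_j}`. -/
def eqj (j : Fin 2) (t : ℝ) (s : State) : V := attErr (qDes sigma P R K j t s) (State.q s j)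

/-- Cable angular velocity error `e_{ω_j}`. -/
def ewj (j : Fin 2) (t : ℝ) (s : State) : V :=
  angErr (State.q s j) (State.w s j) (wDes sigma P R K j t s)

/-- The thrust component along `q_j`:
`μ_j + m_Q (ẍ_r^∥ + g e₃^∥ + L_c ‖ω_j‖² q_j + (-1)^j L_r q̈_r^∥)`. -/
def uPar (t : ℝ) (s : State) (j : Fin 2) : V :=
  mu sigma P R K t s j
    + P.mQ • (inner ℝ (State.q s j) (endAcc P (mu sigma P R K t s) s j) • State.q s j
        + (P.Lc * ‖State.w s j‖ ^ 2) • State.q s j)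

/-- The thrust component orthogonal to `q_j`:
`-m_Q q̂_j² [ẍ_r + (-1)^j L_r q̈_r + g e₃ + L_c q̂_j ω̃_j' - L_c (q_jᵀ ω̃_j) ω_j]
  - m_Q L_c q̂_j [k_{q_j} e_{q_j} + k_{ω_j} e_{ω_j}]`. -/
def uPerp (t : ℝ) (s : State) (j : Fin 2) : V :=
  -(P.mQ • hat (State.q s j) (hat (State.q s j)
      (endAcc P (mu sigma P R K t s) s j
        + P.Lc • hat (State.q s j) (wDesDot sigma P R K j t s)
        - (P.Lc * inner ℝ (State.q s j) (wDes sigma P R K j t s)) • State.w s j)))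
    - (P.mQ * P.Lc) • hat (State.q s j)
        (K.kq j • eqj sigma P R K j t s + K.kw j • ewj sigma P R K j t s)

/-- The closed-loop right-hand side. -/
def closedLoop (t : ℝ) (s : State) : State :=
  reducedField P (mu sigma P R K t s)
    (fun j => uPar sigma P R K t s j + uPerp sigma P R K t s j) s

/-- `s` solves the closed-loop system on the time interval `I`. -/
def IsSolutionOn (s : ℝ → State) (I : Set ℝ) : Prop :=
  ∀ t ∈ I, HasDerivWithinAt s (closedLoop sigma P R K t (s t)) I t

/-! ### Exponential stability -/

/-- Euclidean norm of the vector of all tracking errors. -/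
def errNorm (t : ℝ) (s : State) : ℝ :=
  √(‖ex R t s‖ ^ 2 + ‖ev R t s‖ ^ 2 + ‖eqr R t s‖ ^ 2 + ‖ewr R t s‖ ^ 2
    + ∑ j, (‖eqj sigma P R K j t s‖ ^ 2 + ‖ewj sigma P R K j t s‖ ^ 2))

/-- The set of initial states at time `t`: the cable attitude errors obey `Ψ_j ≤ ψ_j`,
all other errors are bounded by `δ`. -/
structure InDomain (psi : Fin 2 → ℝ) (delta t : ℝ) (s : State) : Prop where
  phase : OnPhaseSpace s
  ex_le : ‖ex R t s‖ ≤ delta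
  ev_le : ‖ev R t s‖ ≤ delta
  Psi_r_le : Psi (R.q t) (State.qr s) ≤ delta
  ewr_le : ‖ewr R t s‖ ≤ delta
  Psi_le : ∀ j, Psi (qDes sigma P R K j t s) (State.q s j) ≤ psi j
  ew_le : ∀ j, ‖ewj sigma P R K j t s‖ ≤ delta

/-- Exponential stability, uniformly in the initial time, of the zero equilibrium of the tracking
errors, with a domain of attraction that contains all cable attitude errors with `Ψ_j ≤ ψ_j`
(and a neighbourhood of zero in the other errors). From every initial state in the domain there is
a solution for all later times, and every solution, on whatever interval, obeys the exponential
estimate and stays in the region `Ψ < 1`, where a vanishing attitude error means that the attitude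
is the desired one (and not its antipode). -/
def ExponentiallyStable (psi : Fin 2 → ℝ) : Prop :=
  ∃ delta > 0, ∃ C > 0, ∃ rate > 0, ∀ t₀ : ℝ, 0 ≤ t₀ → ∀ s₀ : State,
    InDomain sigma P R K psi delta t₀ s₀ →
    (∃ s : ℝ → State, s t₀ = s₀ ∧ IsSolutionOn sigma P R K s (Set.Ici t₀)) ∧
    ∀ (T : ℝ) (s : ℝ → State), s t₀ = s₀ → IsSolutionOn sigma P R K s (Set.Ico t₀ T) →
      ∀ t ∈ Set.Ico t₀ T,
        errNorm sigma P R K t (s t)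
            ≤ C * errNorm sigma P R K t₀ s₀ * Real.exp (-rate * (t - t₀)) ∧
        Psi (R.q t) (State.qr (s t)) < 1 ∧
        ∀ j, Psi (qDes sigma P R K j t (s t)) (State.q (s t) j) < 1

end Control

/-- The cable attitude error bound `α = 2 max (α₁, α₂)` with `α_j = √(ψ_j (2 - ψ_j))`. -/
def alpha (psi : Fin 2 → ℝ) : ℝ :=
  2 * max (√(psi 0 * (2 - psi 0))) (√(psi 1 * (2 - psi 1)))

end

end RodTransport

/-! The closed loop is a cascade. The thrusts cancel the cable dynamics exactly, so each cable
attitude obeys a damped spring equation about `qDes` with no disturbance (`closedLoop_cable`). The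
rod sees the cables only through the force errors `forceErr`, and these are at most `‖μ̃_j‖
‖e_{q_j}‖` (`norm_forceErr_le`), hence linear in the cable errors while the desired forces stay
bounded. If the rod feedback has `σ = -1`, it cancels the drift; for `σ = 1` a residue remains, but
it carries the factor `q_rᵀ ω̃_r`, which is bounded by a multiple of `‖e_{q_r}‖`, so enough
stiffness absorbs it (`norm_rodDist_le`).

Each subsystem has an energy with a cross term, `posLyap` or `attLyap`, whose derivative is negative
definite up to the coupling (`hasDerivWithinAt_attLyap`). Weighting the cable energies by a large
constant dominates the coupling (`lyap_rate_le`). The sum `lyap` is comparable to `errNorm ^ 2`,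
which gives exponential decay.

All of this is local: it needs the rod within a distance `r` of the reference, where the desired
forces are bounded away from zero. A solution starting in the sublevel set `lyap < r ^ 2 / 4` can
never leave that region (`near_of_lyap_lt`), and the same trapping puts solutions in compact tubes,
so they exist for all time.

The choices are not circular: the reference bound `B` fixes the rod gains; these fix `r`, `c`, `M`
and the bound `B₁` on the desired cable angular velocities; `B₁` fixes the cable gains; then come
the cable weight and the size of the domain. The gains do not depend on `psi`, only `alpha₀`
restricts it. -/

namespace RodTransport

/-! ### Existence and uniqueness for time-dependent equations from a priori compactness. -/

section ODE

open Set Filter Topology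

/-- Continuous induction on a half-open interval. -/
theorem forall_Ico_of_continuation {Q : ℝ → Prop} {a b : ℝ} (ha : Q a)
    (hleft : ∀ τ ∈ Ioo a b, (∀ t ∈ Ico a τ, Q t) → Q τ)
    (hright : ∀ τ ∈ Ico a b, (∀ t ∈ Icc a τ, Q t) → ∀ᶠ t in 𝓝[>] τ, Q t) :
    ∀ t ∈ Ico a b, Q t := by
  -- The infimum `τ` of the failure set satisfies `Q` by `hleft`, and `hright` then pushes the
  -- infimum strictly past `τ`.
  by_contra! hcon
  obtain ⟨t₁, ht₁, hQ₁⟩ := hcon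
  set S : Set ℝ := {t | t ∈ Ico a b ∧ ¬ Q t} with hS
  have hSne : S.Nonempty := ⟨t₁, ht₁, hQ₁⟩
  have hSbdd : BddBelow S := ⟨a, fun t ht => ht.1.1⟩
  set τ := sInf S with hτ
  have haτ : a ≤ τ := le_csInf hSne fun t ht => ht.1.1
  have hτb : τ < b := (csInf_le hSbdd ⟨ht₁, hQ₁⟩).trans_lt ht₁.2
  have hlt : ∀ t ∈ Ico a τ, Q t := fun t ht => by
    by_contra h
    exact absurd (csInf_le hSbdd (show t ∈ S from ⟨⟨ht.1, ht.2.trans hτb⟩, h⟩)) (not_le.2 ht.2)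
  have hτQ : Q τ := by
    rcases haτ.eq_or_lt with h | h
    · exact h ▸ ha
    · exact hleft τ ⟨h, hτb⟩ hlt
  have hle : ∀ t ∈ Icc a τ, Q t := fun t ht => by
    rcases ht.2.eq_or_lt with h | h
    · exact h ▸ hτQ
    · exact hlt t ⟨ht.1, h⟩
  obtain ⟨u, hu, hmem⟩ := mem_nhdsGT_iff_exists_Ioo_subset.1 (hright τ ⟨haτ, hτb⟩ hle)
  have hu' : u ≤ τ := by
    refine le_csInf hSne fun t ht => ?_
    by_contra h
    have h2 : τ ≤ t := csInf_le hSbdd ht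
    rcases h2.eq_or_lt with h3 | h3
    · exact ht.2 (h3 ▸ hτQ)
    · exact ht.2 (hmem ⟨h3, not_le.1 h⟩)
  exact absurd hu (not_lt.2 hu')

variable {E : Type*} [NormedAddCommGroup E] [NormedSpace ℝ E]

/-- A `C¹` function on an open set agrees near a compact subset with a bounded Lipschitz
function. -/
theorem exists_lipschitz_eq_nhdsSet {G : Type*} [NormedAddCommGroup G] [NormedSpace ℝ G]
    [FiniteDimensional ℝ G] {U K : Set G} (hU : IsOpen U) {f : G → E}
    (hf : ContDiffOn ℝ 1 f U) (hK : IsCompact K) (hKU : K ⊆ U) :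
    ∃ F : G → E, (∃ C, LipschitzWith C F) ∧ (∃ L : ℝ, ∀ p, ‖F p‖ ≤ L) ∧
      ∀ᶠ p in 𝓝ˢ K, F p = f p := by
  -- A cutoff equal to `1` near `K` and supported in `N` turns `f` into a compactly supported `C¹`
  -- map, which is bounded and Lipschitz. Agreement on a neighbourhood of `K`, not just on `K`, is
  -- what lets solutions be continued beyond a time at which they lie in `K`.
  obtain ⟨N, hNc, hKN, hNU⟩ := exists_compact_between hK hU hKU
  obtain ⟨χ, hχ1, hχ0, -⟩ := exists_contMDiffMap_one_nhds_of_subset_interior (n := 1)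
    (modelWithCornersSelf ℝ G) hK.isClosed hKN
  have hχ : ContDiff ℝ 1 χ := χ.contMDiff.contDiff
  have hsupp : tsupport (fun p => χ p • f p) ⊆ N := by
    refine closure_minimal (fun p hp => ?_) hNc.isClosed
    by_contra h
    exact hp (by simp [hχ0 p h])
  have hcs : HasCompactSupport (fun p => χ p • f p) := hNc.of_isClosed_subset isClosed_closure hsupp
  have hsm : ContDiff ℝ 1 (fun p => χ p • f p) := by
    rw [contDiff_iff_contDiffAt]
    intro p
    by_cases hp : p ∈ U
    · exact hχ.contDiffAt.smul (hf.contDiffAt (hU.mem_nhds hp))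
    · have : (fun p => χ p • f p) =ᶠ[𝓝 p] fun _ => 0 :=
        notMem_tsupport_iff_eventuallyEq.1 fun h => hp (hNU (hsupp h))
      exact contDiffAt_const.congr_of_eventuallyEq this
  refine ⟨fun p => χ p • f p, ContDiff.lipschitzWith_of_hasCompactSupport hcs hsm one_ne_zero,
    hcs.exists_bound_of_continuous hsm.continuous, ?_⟩
  filter_upwards [hχ1] with p hp
  simp [hp]

variable [FiniteDimensional ℝ E]

/-- A bounded Lipschitz time-dependent vector field has solutions on every compact interval. -/
theorem exists_solution_Icc_of_lipschitz {F : ℝ × E → E} (hF : ∃ C, LipschitzWith C F)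
    (hL : ∃ L : ℝ, ∀ p, ‖F p‖ ≤ L) {t₀ T : ℝ} (hT : t₀ ≤ T) (s₀ : E) :
    ∃ s : ℝ → E, s t₀ = s₀ ∧ ∀ t ∈ Icc t₀ T, HasDerivWithinAt s (F (t, s t)) (Icc t₀ T) t := by
  obtain ⟨C, hC⟩ := hF
  obtain ⟨L, hL⟩ := hL
  have hL0 : 0 ≤ L := (norm_nonneg _).trans (hL (0, 0))
  -- The global bound `L` allows a ball of radius `L * (T - t₀)`, so the Picard–Lindelöf interval is
  -- all of `[t₀, T]`.
  have hPL : IsPicardLindelof (fun t x => F (t, x)) (⟨t₀, left_mem_Icc.2 hT⟩ : Icc t₀ T) s₀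
      ⟨L * (T - t₀), mul_nonneg hL0 (sub_nonneg.2 hT)⟩ 0 ⟨L, hL0⟩ C := by
    refine ⟨fun t _ => ?_, fun x _ => ?_, fun t _ x _ => hL _, ?_⟩
    · refine (LipschitzWith.of_dist_le_mul fun x y => ?_).lipschitzOnWith
      simpa [Prod.dist_eq] using hC.dist_le_mul (t, x) (t, y)
    · exact (hC.continuous.comp (by fun_prop)).continuousOn
    · change L * max (T - t₀) (t₀ - t₀) ≤ L * (T - t₀) - 0
      simp [hT]
  exact hPL.exists_eq_forall_mem_Icc_hasDerivWithinAt₀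

/-- Two solutions of a `C¹` equation that stay in a common compact set agree. -/
theorem eqOn_Ico_of_solutions {U K : Set (ℝ × E)} (hU : IsOpen U) {f : ℝ → E → E}
    (hf : ContDiffOn ℝ 1 (fun p : ℝ × E => f p.1 p.2) U) (hK : IsCompact K) (hKU : K ⊆ U)
    {t₀ T : ℝ} {s r : ℝ → E} (h0 : s t₀ = r t₀)
    (hs : ∀ t ∈ Ico t₀ T, HasDerivWithinAt s (f t (s t)) (Ico t₀ T) t)
    (hr : ∀ t ∈ Ico t₀ T, HasDerivWithinAt r (f t (r t)) (Ico t₀ T) t)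
    (hsK : ∀ t ∈ Ico t₀ T, (t, s t) ∈ K) (hrK : ∀ t ∈ Ico t₀ T, (t, r t) ∈ K) :
    EqOn s r (Ico t₀ T) := by
  obtain ⟨F, ⟨C, hC⟩, -, hFf⟩ := exists_lipschitz_eq_nhdsSet hU hf hK hKU
  have hKF : ∀ p ∈ K, F p = f p.1 p.2 := fun p hp => hFf.self_of_nhdsSet p hp
  intro τ hτ
  have hsub : Icc t₀ τ ⊆ Ico t₀ T := fun t ht => ⟨ht.1, ht.2.trans_lt hτ.2⟩
  have key : ∀ w : ℝ → E, (∀ t ∈ Ico t₀ T, HasDerivWithinAt w (f t (w t)) (Ico t₀ T) t) →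
      (∀ t ∈ Ico t₀ T, (t, w t) ∈ K) → ContinuousOn w (Icc t₀ τ) ∧
      ∀ t ∈ Ico t₀ τ, HasDerivWithinAt w (F (t, w t)) (Ici t) t := by
    intro w hw hwK
    refine ⟨fun t ht => ((hw t (hsub ht)).continuousWithinAt).mono hsub, fun t ht => ?_⟩
    have htI := hsub ⟨ht.1, ht.2.le⟩
    rw [hKF _ (hwK t htI)]
    refine (hw t htI).mono_of_mem_nhdsWithin ?_
    exact mem_of_superset (Ico_mem_nhdsGE htI.2) (Ico_subset_Ico_left ht.1)
  exact ODE_solution_unique (v := fun t x => F (t, x)) (K := C)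
    (fun t => LipschitzWith.of_dist_le_mul fun x y => by
      simpa [Prod.dist_eq] using hC.dist_le_mul (t, x) (t, y))
    (key s hs hsK).1 (key s hs hsK).2 (key r hr hrK).1 (key r hr hrK).2 h0 ⟨hτ.1, le_rfl⟩

/-- If an a priori estimate keeps all solutions in a compact subset of the domain, then solutions
exist on the whole interval. -/
theorem exists_solution_Ico_of_mem_compact {U K : Set (ℝ × E)} (hU : IsOpen U) {f : ℝ → E → E}
    (hf : ContDiffOn ℝ 1 (fun p : ℝ × E => f p.1 p.2) U) (hK : IsCompact K) (hKU : K ⊆ U)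
    {t₀ T : ℝ} (hT : t₀ ≤ T) {s₀ : E} (h0 : (t₀, s₀) ∈ K)
    (hpri : ∀ τ ≤ T, ∀ s : ℝ → E, s t₀ = s₀ →
      (∀ t ∈ Ico t₀ τ, HasDerivWithinAt s (f t (s t)) (Ico t₀ τ) t) →
      ∀ t ∈ Ico t₀ τ, (t, s t) ∈ K) :
    ∃ s : ℝ → E, s t₀ = s₀ ∧ ∀ t ∈ Ico t₀ T, HasDerivWithinAt s (f t (s t)) (Ico t₀ T) t := by
  obtain ⟨F, hC, hL, hFf⟩ := exists_lipschitz_eq_nhdsSet hU hf hK hKU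
  obtain ⟨s, hs0, hs⟩ := exists_solution_Icc_of_lipschitz hC hL hT s₀
  have hcont : ContinuousOn (fun t => (t, s t)) (Icc t₀ T) :=
    continuousOn_id.prodMk fun t ht => (hs t ht).continuousWithinAt
  have hKF : ∀ p ∈ K, F p = f p.1 p.2 := fun p hp => hFf.self_of_nhdsSet p hp
  -- Here `s` solves the truncated equation. Membership in `K` passes to left limits because `K` is
  -- closed. To the right, `F = f` near `(τ, s τ)`, so `s` solves the true equation slightly past
  -- `τ` and the a priori estimate applies there.
  have hmem : ∀ t ∈ Ico t₀ T, (t, s t) ∈ K := by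
    refine forall_Ico_of_continuation (hs0 ▸ h0) (fun τ hτ hlt => ?_) (fun τ hτ hle => ?_)
    · have hc : ContinuousWithinAt (fun t => (t, s t)) (Ico t₀ τ) τ :=
        (hcont τ ⟨hτ.1.le, hτ.2.le⟩).mono fun t ht => ⟨ht.1, ht.2.le.trans hτ.2.le⟩
      have hcl : τ ∈ closure (Ico t₀ τ) := by
        rw [closure_Ico hτ.1.ne]; exact ⟨hτ.1.le, le_rfl⟩
      exact hK.isClosed.closure_subset_iff.2 (image_subset_iff.2 hlt) (hc.mem_closure_image hcl)
    · have hev : ∀ᶠ t in 𝓝[Icc t₀ T] τ, F (t, s t) = f t (s t) :=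
        (hcont τ ⟨hτ.1, hτ.2.le⟩).eventually
          (eventually_nhdsSet_iff_forall.1 hFf _ (hle τ ⟨hτ.1, le_rfl⟩))
      have hev' : ∀ᶠ t in 𝓝[≥] τ, F (t, s t) = f t (s t) := by
        refine nhdsWithin_le_iff.2 ?_ hev
        exact mem_of_superset (Icc_mem_nhdsGE hτ.2) (Icc_subset_Icc_left hτ.1)
      obtain ⟨u, hu, hmemu⟩ := (mem_nhdsGE_iff_exists_Ico_subset' hτ.2).1 hev'
      have hu1 : τ < min u T := lt_min hu hτ.2
      have hsub : Ico t₀ (min u T) ⊆ Icc t₀ T := fun t ht =>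
        ⟨ht.1, ht.2.le.trans (min_le_right _ _)⟩
      have hsol : ∀ t ∈ Ico t₀ (min u T),
          HasDerivWithinAt s (f t (s t)) (Ico t₀ (min u T)) t := by
        intro t ht
        have hFt : F (t, s t) = f t (s t) := by
          rcases le_total t τ with h | h
          · exact hKF _ (hle t ⟨ht.1, h⟩)
          · exact hmemu ⟨h, ht.2.trans_le (min_le_left _ _)⟩
        exact hFt ▸ (hs t (hsub ht)).mono hsub
      have := hpri _ (min_le_right _ _) s hs0 hsol
      filter_upwards [Ioo_mem_nhdsGT hu1] with t ht
      exact this t ⟨hτ.1.trans ht.1.le, ht.2⟩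
  refine ⟨s, hs0, fun t ht => ?_⟩
  rw [← hKF _ (hmem t ht)]
  exact (hs t ⟨ht.1, ht.2.le⟩).mono Ico_subset_Icc_self

/-- Global existence from a priori estimates on all compact time intervals. -/
theorem exists_solution_Ici_of_mem_compact {U : Set (ℝ × E)} (hU : IsOpen U) {f : ℝ → E → E}
    (hf : ContDiffOn ℝ 1 (fun p : ℝ × E => f p.1 p.2) U) {t₀ : ℝ} {s₀ : E}
    {K : ℝ → Set (ℝ × E)} (hK : ∀ T, IsCompact (K T)) (hKU : ∀ T, K T ⊆ U)
    (h0 : ∀ T, t₀ ≤ T → (t₀, s₀) ∈ K T)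
    (hpri : ∀ T, ∀ τ ≤ T, ∀ s : ℝ → E, s t₀ = s₀ →
      (∀ t ∈ Ico t₀ τ, HasDerivWithinAt s (f t (s t)) (Ico t₀ τ) t) →
      ∀ t ∈ Ico t₀ τ, (t, s t) ∈ K T) :
    ∃ s : ℝ → E, s t₀ = s₀ ∧ ∀ t ∈ Ici t₀, HasDerivWithinAt s (f t (s t)) (Ici t₀) t := by
  have hex : ∀ n : ℕ, ∃ s : ℝ → E, s t₀ = s₀ ∧ ∀ t ∈ Ico t₀ (t₀ + n + 1),
      HasDerivWithinAt s (f t (s t)) (Ico t₀ (t₀ + n + 1)) t := fun n => by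
    have hn : (0 : ℝ) ≤ n := n.cast_nonneg
    exact exists_solution_Ico_of_mem_compact hU hf (hK (t₀ + n + 1)) (hKU _) (by linarith)
      (h0 _ (by linarith)) (hpri _)
  choose σ hσ0 hσ using hex
  have hagree : ∀ m n : ℕ, m ≤ n → EqOn (σ m) (σ n) (Ico t₀ (t₀ + m + 1)) := fun m n hmn => by
    have hmn' : (m : ℝ) ≤ n := by exact_mod_cast hmn
    have hsub : Ico t₀ (t₀ + m + 1) ⊆ Ico t₀ (t₀ + n + 1) :=
      Ico_subset_Ico_right (by linarith)
    have hn : ∀ t ∈ Ico t₀ (t₀ + m + 1),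
      HasDerivWithinAt (σ n) (f t (σ n t)) (Ico t₀ (t₀ + m + 1)) t :=
      fun t ht => (hσ n t (hsub ht)).mono hsub
    exact eqOn_Ico_of_solutions hU hf (hK _) (hKU _) ((hσ0 m).trans (hσ0 n).symm) (hσ m) hn
      (hpri _ _ le_rfl _ (hσ0 m) (hσ m)) (hpri _ _ le_rfl _ (hσ0 n) hn)
  have hglue : ∀ n : ℕ, ∀ t ∈ Ico t₀ (t₀ + n + 1), σ ⌊t - t₀⌋₊ t = σ n t := fun n t ht => by
    have h1 : ⌊t - t₀⌋₊ ≤ n := by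
      rw [← Nat.lt_succ_iff, Nat.floor_lt (sub_nonneg.2 ht.1)]
      push_cast
      linarith [ht.2]
    have h2 := Nat.lt_floor_add_one (t - t₀)
    exact hagree _ _ h1 ⟨ht.1, by linarith⟩
  -- By uniqueness the solutions on `[t₀, t₀ + n + 1)` are nested; the floor selects one that is
  -- defined at `t`.
  refine ⟨fun t => σ ⌊t - t₀⌋₊ t, by simp [hσ0], fun t ht => ?_⟩
  obtain ⟨n, hn⟩ := exists_nat_gt (t - t₀)
  have htn : t ∈ Ico t₀ (t₀ + n + 1) := ⟨ht, by linarith⟩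
  have hnhds : Ico t₀ (t₀ + n + 1) ∈ 𝓝[Ici t₀] t := by
    rw [← Ici_inter_Iio]
    exact inter_mem self_mem_nhdsWithin (mem_nhdsWithin_of_mem_nhds (Iio_mem_nhds htn.2))
  have hd : HasDerivWithinAt (fun t => σ ⌊t - t₀⌋₊ t) (f t (σ n t)) (Ico t₀ (t₀ + n + 1)) t :=
    (hσ n t htn).congr (fun r hr => hglue n r hr) (hglue n t htn)
  simpa only [hglue n t htn] using hd.mono_of_mem_nhdsWithin hnhds

end ODE

/-! ### The cross product on Euclidean three-space -/

theorem inner_eq_sum (a b : V) : inner ℝ a b = a 0 * b 0 + a 1 * b 1 + a 2 * b 2 := by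
  simp [PiLp.inner_apply, Fin.sum_univ_three, mul_comm]

theorem hat_apply_zero (a b : V) : hat a b 0 = a 1 * b 2 - a 2 * b 1 := by
  simp [hat, cross_apply]

theorem hat_apply_one (a b : V) : hat a b 1 = a 2 * b 0 - a 0 * b 2 := by
  simp [hat, cross_apply]

theorem hat_apply_two (a b : V) : hat a b 2 = a 0 * b 1 - a 1 * b 0 := by
  simp [hat, cross_apply]

theorem hat_hat (a b c : V) : hat a (hat b c) = inner ℝ a c • b - inner ℝ a b • c := by
  ext i
  fin_cases i <;>
    simp [hat_apply_zero, hat_apply_one, hat_apply_two, inner_eq_sum] <;> ring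

theorem hat_anticomm (a b : V) : hat a b = -hat b a := by
  ext i
  fin_cases i <;>
    simp [hat_apply_zero, hat_apply_one, hat_apply_two] <;> ring

theorem hat_self (a : V) : hat a a = 0 := by
  ext i
  fin_cases i <;>
    simp [hat_apply_zero, hat_apply_one, hat_apply_two] <;> ring

theorem inner_hat_left (a b : V) : inner ℝ a (hat a b) = 0 := by
  simp only [inner_eq_sum, hat_apply_zero, hat_apply_one, hat_apply_two]
  ring

theorem inner_hat_right (a b : V) : inner ℝ b (hat a b) = 0 := by
  simp only [inner_eq_sum, hat_apply_zero, hat_apply_one, hat_apply_two]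
  ring

theorem norm_hat_sq (a b : V) : ‖hat a b‖ ^ 2 = ‖a‖ ^ 2 * ‖b‖ ^ 2 - inner ℝ a b ^ 2 := by
  simp only [← real_inner_self_eq_norm_sq, inner_eq_sum, hat_apply_zero, hat_apply_one,
    hat_apply_two]
  ring

theorem norm_hat_le (a b : V) : ‖hat a b‖ ≤ ‖a‖ * ‖b‖ := by
  refine abs_le_of_sq_le_sq' ?_ (by positivity) |>.2
  rw [norm_hat_sq, mul_pow]
  linarith [sq_nonneg (inner ℝ a b)]

/-- The cross product as a continuous bilinear map. -/
noncomputable def hatL : V →L[ℝ] V →L[ℝ] V :=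
  LinearMap.mkContinuous₂ (LinearMap.mk₂ ℝ hat
    (fun a b c => by
      ext i
      fin_cases i <;> simp [hat_apply_zero, hat_apply_one, hat_apply_two] <;> ring)
    (fun r a b => by
      ext i
      fin_cases i <;> simp [hat_apply_zero, hat_apply_one, hat_apply_two] <;> ring)
    (fun a b c => by
      ext i
      fin_cases i <;> simp [hat_apply_zero, hat_apply_one, hat_apply_two] <;> ring)
    (fun r a b => by
      ext i
      fin_cases i <;> simp [hat_apply_zero, hat_apply_one, hat_apply_two] <;> ring)) 1
    (fun a b => by simpa using norm_hat_le a b)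

theorem hatL_apply (a b : V) : hatL a b = hat a b := rfl

theorem hat_add_right (a b c : V) : hat a (b + c) = hat a b + hat a c := by
  simp [← hatL_apply]

theorem hat_sub_left (a b c : V) : hat (a - b) c = hat a c - hat b c := by
  simp [← hatL_apply]

theorem hat_sub_right (a b c : V) : hat a (b - c) = hat a b - hat a c := by
  simp [← hatL_apply]

theorem hat_smul_right (r : ℝ) (a b : V) : hat a (r • b) = r • hat a b := by
  simp [← hatL_apply]

theorem hat_neg_right (a b : V) : hat a (-b) = -hat a b := by
  simp [← hatL_apply]

theorem _root_.HasDerivWithinAt.hat {a b : ℝ → V} {a' b' : V} {I : Set ℝ} {t : ℝ}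
    (ha : HasDerivWithinAt a a' I t) (hb : HasDerivWithinAt b b' I t) :
    HasDerivWithinAt (fun t => hat (a t) (b t)) (RodTransport.hat a' (b t)
      + RodTransport.hat (a t) b') I t := by
  have h1 : HasDerivWithinAt (fun t => hatL (a t)) (hatL a') I t :=
    hatL.hasFDerivAt.comp_hasDerivWithinAt t ha
  exact h1.clm_apply hb

theorem contDiff_hat {n : WithTop ℕ∞} : ContDiff ℝ n (fun x : V × V => hat x.1 x.2) :=
  hatL.isBoundedBilinearMap.contDiff

@[fun_prop]
theorem _root_.ContDiff.hat {G : Type*} [NormedAddCommGroup G] [NormedSpace ℝ G]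
    {n : WithTop ℕ∞} {f g : G → V} (hf : ContDiff ℝ n f) (hg : ContDiff ℝ n g) :
    ContDiff ℝ n (fun x => RodTransport.hat (f x) (g x)) :=
  contDiff_hat.comp (hf.prodMk hg)

@[fun_prop]
theorem _root_.ContDiffAt.hat {G : Type*} [NormedAddCommGroup G] [NormedSpace ℝ G]
    {n : WithTop ℕ∞} {f g : G → V} {x : G} (hf : ContDiffAt ℝ n f x) (hg : ContDiffAt ℝ n g x) :
    ContDiffAt ℝ n (fun x => RodTransport.hat (f x) (g x)) x :=
  contDiff_hat.contDiffAt.comp x (hf.prodMk hg)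

/-! ### Attitude errors of unit vectors -/

theorem hat_hat_self {q : V} (hq : ‖q‖ = 1) (z : V) :
    hat q (hat q z) = inner ℝ q z • q - z := by
  rw [hat_hat, real_inner_self_eq_norm_sq, hq]; simp

theorem hat_hat_of_orthogonal {q z : V} (hq : ‖q‖ = 1) (hz : inner ℝ q z = 0) :
    hat q (hat q z) = -z := by
  rw [hat_hat_self hq, hz]; simp

theorem norm_attErr_sq {p q : V} (hp : ‖p‖ = 1) (hq : ‖q‖ = 1) :
    ‖attErr p q‖ ^ 2 = Psi p q * (2 - Psi p q) := by
  rw [attErr, norm_hat_sq, hp, hq, Psi]; ring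

theorem norm_sub_sq_eq_two_mul_Psi {p q : V} (hp : ‖p‖ = 1) (hq : ‖q‖ = 1) :
    ‖q - p‖ ^ 2 = 2 * Psi p q := by
  rw [norm_sub_sq_real, hp, hq, Psi, real_inner_comm]; ring

theorem Psi_nonneg {p q : V} (hp : ‖p‖ = 1) (hq : ‖q‖ = 1) : 0 ≤ Psi p q := by
  linarith [norm_sub_sq_eq_two_mul_Psi hp hq, sq_nonneg ‖q - p‖]

theorem norm_attErr_sq_le {p q : V} (hp : ‖p‖ = 1) (hq : ‖q‖ = 1) :
    ‖attErr p q‖ ^ 2 ≤ 2 * Psi p q := by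
  rw [norm_attErr_sq hp hq]; nlinarith [sq_nonneg (Psi p q)]

theorem Psi_le_norm_attErr_sq {p q : V} (hp : ‖p‖ = 1) (hq : ‖q‖ = 1) (h : Psi p q ≤ 1) :
    Psi p q ≤ ‖attErr p q‖ ^ 2 := by
  rw [norm_attErr_sq hp hq]; nlinarith [Psi_nonneg hp hq]

theorem norm_attErr_le_one {p q : V} (hp : ‖p‖ = 1) (hq : ‖q‖ = 1) : ‖attErr p q‖ ≤ 1 := by
  simpa [attErr, hp, hq] using norm_hat_le p q

/-- Only the component of `q` orthogonal to `p` pairs with `z`, and that component has length `‖p ×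
q‖`. This converts drift factors such as `q_rᵀ ω̃_r` into attitude errors. -/
theorem abs_inner_le_of_orthogonal {p z : V} (hp : ‖p‖ = 1) (q : V)
    (hz : inner ℝ p z = 0) : |inner ℝ q z| ≤ ‖z‖ * ‖attErr p q‖ := by
  have h1 : inner ℝ q z = inner ℝ (hat p (hat p q)) (-z) := by
    rw [hat_hat_self hp, inner_neg_right, inner_sub_left, inner_smul_left, hz]; simp
  rw [h1]
  refine (abs_real_inner_le_norm _ _).trans ?_
  rw [norm_neg, mul_comm]
  gcongr
  simpa [attErr, hp] using norm_hat_le p (hat p q)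

theorem inner_angErr {q w : V} (hqw : inner ℝ q w = 0) (z : V) :
    inner ℝ q (angErr q w z) = 0 := by
  rw [angErr, inner_add_right, hqw, inner_hat_left, add_zero]

theorem norm_le_norm_angErr_add {q w z : V} (hq : ‖q‖ = 1) :
    ‖w‖ ≤ ‖angErr q w z‖ + ‖z‖ := by
  have h1 : w = angErr q w z - hat q (hat q z) := by simp [angErr]
  have h2 : ‖hat q (hat q z)‖ ≤ ‖z‖ := by
    refine (norm_hat_le _ _).trans ?_
    simpa [hq] using norm_hat_le q z
  calc ‖w‖ = ‖angErr q w z - hat q (hat q z)‖ := by rw [← h1]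
    _ ≤ _ := (norm_sub_le _ _).trans (by linarith)

/-- The Lyapunov function of an attitude error with stiffness `k`. -/
noncomputable def attLyap (k : ℝ) (p z q w : V) : ℝ :=
  1 / 2 * ‖angErr q w z‖ ^ 2 + k * Psi p q + inner ℝ (attErr p q) (angErr q w z)

/-- The cross term costs at most `‖e‖² / 4 + ‖attErr‖²`, and `‖attErr‖² ≤ 2 Ψ`, so stiffness `3`
leaves one copy of `Ψ`. -/
theorem le_attLyap {k : ℝ} (hk : 3 ≤ k) {p q : V} (hp : ‖p‖ = 1) (hq : ‖q‖ = 1) (z w : V) :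
    1 / 4 * ‖angErr q w z‖ ^ 2 + Psi p q ≤ attLyap k p z q w := by
  have h1 := (abs_le.1 (abs_real_inner_le_norm (attErr p q) (angErr q w z))).1
  have h2 := norm_attErr_sq_le hp hq
  rw [attLyap]
  nlinarith [sq_nonneg (‖attErr p q‖ - 1 / 2 * ‖angErr q w z‖), Psi_nonneg hp hq]

theorem attLyap_le {k : ℝ} (p q z w : V) :
    attLyap k p z q w ≤ ‖angErr q w z‖ ^ 2 + k * Psi p q + ‖attErr p q‖ ^ 2 := by
  have h1 := real_inner_le_norm (attErr p q) (angErr q w z)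
  rw [attLyap]
  nlinarith [sq_nonneg (‖attErr p q‖ - ‖angErr q w z‖), sq_nonneg ‖attErr p q‖]

/-- The stiffness that makes `attLyap` decay, for desired angular velocities bounded by `B` and
disturbances bounded by `b` times the attitude error. -/
noncomputable def stiffness (B b : ℝ) : ℝ := b + (B + 2 + b) ^ 2 / 2 + 3

theorem three_le_stiffness {B b : ℝ} (hb : 0 ≤ b) : 3 ≤ stiffness B b := by
  rw [stiffness]; nlinarith [sq_nonneg (B + 2 + b)]

/-! ### Attitude errors along moving pairs of unit vectors. -/

section Curves

variable {q w p z : ℝ → V} {I : Set ℝ} {t : ℝ} {w' z' : V}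

theorem hasDerivWithinAt_angErr
    (hq : HasDerivWithinAt q (hat (w t) (q t)) I t) (hw : HasDerivWithinAt w w' I t)
    (hz : HasDerivWithinAt z z' I t) :
    HasDerivWithinAt (fun t => angErr (q t) (w t) (z t))
      (w' + hat (q t) (hat (q t) z') - inner ℝ (q t) (z t) • hat (q t) (w t)
        + inner ℝ (hat (w t) (q t)) (z t) • q t) I t := by
  refine (hw.add (hq.hat (hq.hat hz))).congr_deriv ?_
  have h1 : inner ℝ (hat (w t) (q t)) (q t) = 0 := by
    rw [real_inner_comm, inner_hat_right]
  have h2 : inner ℝ (q t) (hat (w t) (q t)) = 0 := inner_hat_right _ _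
  rw [hat_add_right, hat_hat (hat (w t) (q t)), h1, hat_hat (q t) (hat (w t) (q t)), h2,
    hat_anticomm (w t) (q t)]
  module

theorem hasDerivWithinAt_attErr (hqu : ‖q t‖ = 1) (hpz : inner ℝ (p t) (z t) = 0)
    (hq : HasDerivWithinAt q (hat (w t) (q t)) I t)
    (hp : HasDerivWithinAt p (hat (z t) (p t)) I t) :
    HasDerivWithinAt (fun t => attErr (p t) (q t))
      (inner ℝ (p t) (q t) • angErr (q t) (w t) (z t) + inner ℝ (q t) (z t) • p t
        - inner ℝ (p t) (angErr (q t) (w t) (z t)) • q t) I t := by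
  refine (hp.hat hq).congr_deriv ?_
  rw [hat_anticomm (hat _ _), hat_hat, hat_hat, angErr, hat_hat_self hqu, inner_add_right,
    inner_sub_right, inner_smul_right, hpz, real_inner_comm (p t) (q t)]
  module

/-- The derivative of `Ψ` is exactly the power `attErr · angErr`, so the potential `k Ψ` cancels the
work of the feedback term `-k attErr` in the kinetic energy. -/
theorem hasDerivWithinAt_Psi (hqu : ‖q t‖ = 1)
    (hq : HasDerivWithinAt q (hat (w t) (q t)) I t)
    (hp : HasDerivWithinAt p (hat (z t) (p t)) I t) :
    HasDerivWithinAt (fun t => Psi (p t) (q t))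
      (inner ℝ (attErr (p t) (q t)) (angErr (q t) (w t) (z t))) I t := by
  refine ((hp.inner ℝ hq).const_sub 1).congr_deriv ?_
  rw [angErr, hat_hat_self hqu, attErr, inner_add_right, inner_sub_right, inner_smul_right,
    real_inner_comm (q t) (hat (p t) (q t)), inner_hat_right]
  simp only [inner_eq_sum, hat_apply_zero, hat_apply_one, hat_apply_two]
  ring

/-- Decay of the attitude Lyapunov function under the attitude feedback with disturbance `D`. -/
theorem hasDerivWithinAt_attLyap {B b d : ℝ} {D : V} (hqu : ‖q t‖ = 1) (hpu : ‖p t‖ = 1)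
    (hqw : inner ℝ (q t) (w t) = 0) (hpz : inner ℝ (p t) (z t) = 0)
    (hq : HasDerivWithinAt q (hat (w t) (q t)) I t) (hw : HasDerivWithinAt w w' I t)
    (hp : HasDerivWithinAt p (hat (z t) (p t)) I t) (hz : HasDerivWithinAt z z' I t)
    (hfb : w' = -hat (q t) (hat (q t) z') + inner ℝ (q t) (z t) • hat (q t) (w t)
      - stiffness B b • attErr (p t) (q t) - (2 : ℝ) • angErr (q t) (w t) (z t) + D)
    (hB : ‖z t‖ ≤ B) (hD : ‖D‖ ≤ b * ‖attErr (p t) (q t)‖ + d) :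
    ∃ v', HasDerivWithinAt (fun t => attLyap (stiffness B b) (p t) (z t) (q t) (w t)) v' I t ∧
      v' ≤ -(1 / 2) * ‖angErr (q t) (w t) (z t)‖ ^ 2 - 3 * ‖attErr (p t) (q t)‖ ^ 2
        + (‖attErr (p t) (q t)‖ + ‖angErr (q t) (w t) (z t)‖) * d := by
  set k := stiffness B b with hk
  -- The feedforward terms cancel. The remaining multiple of `q` drops out of the estimate, since
  -- both errors are orthogonal to `q`.
  have hE : HasDerivWithinAt (fun t => angErr (q t) (w t) (z t))
      (-(k • attErr (p t) (q t)) - (2 : ℝ) • angErr (q t) (w t) (z t) + D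
        + inner ℝ (hat (w t) (q t)) (z t) • q t) I t := by
    refine (hasDerivWithinAt_angErr hq hw hz).congr_deriv ?_
    rw [hfb]; module
  have hA := hasDerivWithinAt_attErr hqu hpz hq hp
  have hP := hasDerivWithinAt_Psi hqu hq hp
  refine ⟨_, ((hE.norm_sq.const_mul (1 / 2)).add (hP.const_mul k)).add (hA.inner ℝ hE), ?_⟩
  have hqe : inner ℝ (q t) (angErr (q t) (w t) (z t)) = 0 := inner_angErr hqw _
  have hqa : inner ℝ (attErr (p t) (q t)) (q t) = 0 := by
    rw [real_inner_comm]; exact inner_hat_right _ _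
  have hpe := abs_inner_le_of_orthogonal hqu (p t) hqe
  have hae : ‖attErr (q t) (p t)‖ = ‖attErr (p t) (q t)‖ := by
    rw [attErr, hat_anticomm, norm_neg, attErr]
  rw [hae] at hpe
  have hqz := abs_inner_le_of_orthogonal hpu (q t) hpz
  have ha1 := norm_attErr_le_one hpu hqu
  have hpq : inner ℝ (p t) (q t) ≤ 1 := by
    simpa [hpu, hqu] using real_inner_le_norm (p t) (q t)
  set e := angErr (q t) (w t) (z t)
  set a := attErr (p t) (q t)
  have hqe' : inner ℝ e (q t) = 0 := by rw [real_inner_comm]; exact hqe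
  have heD := real_inner_le_norm e D
  have haD := real_inner_le_norm a D
  have hea := (abs_le.1 (abs_real_inner_le_norm a e)).1
  have hcross : inner ℝ (q t) (z t) * inner ℝ (p t) e ≤ B * ‖a‖ * ‖e‖ := by
    refine (le_abs_self _).trans ?_
    rw [abs_mul]
    calc |inner ℝ (q t) (z t)| * |inner ℝ (p t) e| ≤ (‖z t‖ * ‖a‖) * (‖e‖ * ‖a‖) := by gcongr
      _ ≤ (B * ‖a‖) * (‖e‖ * 1) := by
        have : 0 ≤ B := (norm_nonneg _).trans hB
        gcongr
      _ = B * ‖a‖ * ‖e‖ := by ring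
  simp only [inner_add_left, inner_sub_left, inner_add_right, inner_sub_right, inner_smul_left,
    inner_smul_right, inner_neg_right, real_inner_self_eq_norm_sq, hqa, hqe, hqe',
    real_inner_comm a e, RCLike.conj_to_real]
  have hDe : ‖e‖ * ‖D‖ ≤ ‖e‖ * (b * ‖a‖ + d) := by gcongr
  have hDa : ‖a‖ * ‖D‖ ≤ ‖a‖ * (b * ‖a‖ + d) := by gcongr
  have hpq' : inner ℝ (p t) (q t) * ‖e‖ ^ 2 ≤ 1 * ‖e‖ ^ 2 := by gcongr
  -- The mixed terms are `B` from the motion of the target, `2` from the damping inside the cross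
  -- term and `b` from the disturbance. Completing the square produces the middle summand of
  -- `stiffness`.
  have hsq : (B + 2 + b) * (‖a‖ * ‖e‖) ≤ 1 / 2 * ‖e‖ ^ 2 + (B + 2 + b) ^ 2 / 2 * ‖a‖ ^ 2 := by
    nlinarith [sq_nonneg (‖e‖ - (B + 2 + b) * ‖a‖)]
  have hkk : k * ‖a‖ ^ 2 = b * ‖a‖ ^ 2 + (B + 2 + b) ^ 2 / 2 * ‖a‖ ^ 2 + 3 * ‖a‖ ^ 2 := by
    rw [hk, stiffness]; ring
  nlinarith

end Curves

/-! ### Smoothness of the closed loop -/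

section Smoothness

variable {sigma : ℝ} {P : Params} {R : Reference} {K : Gains}

theorem Reference.Admissible.contDiff_v (hR : R.Admissible P) : ContDiff ℝ ∞ R.v :=
  (contDiff_infty_iff_deriv.1 hR.smooth_x).2

theorem Reference.Admissible.contDiff_a (hR : R.Admissible P) : ContDiff ℝ ∞ R.a :=
  (contDiff_infty_iff_deriv.1 hR.contDiff_v).2

theorem Reference.Admissible.contDiff_deriv_q (hR : R.Admissible P) : ContDiff ℝ ∞ (deriv R.q) :=
  (contDiff_infty_iff_deriv.1 hR.smooth_q).2

theorem Reference.Admissible.contDiff_w (hR : R.Admissible P) : ContDiff ℝ ∞ R.w :=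
  hR.smooth_q.hat hR.contDiff_deriv_q

theorem Reference.Admissible.contDiff_wdot (hR : R.Admissible P) : ContDiff ℝ ∞ R.wdot :=
  (contDiff_infty_iff_deriv.1 hR.contDiff_w).2

@[fun_prop]
theorem State.contDiff_xr : ContDiff ℝ ∞ State.xr := by unfold State.xr; fun_prop

@[fun_prop]
theorem State.contDiff_vr : ContDiff ℝ ∞ State.vr := by unfold State.vr; fun_prop

@[fun_prop]
theorem State.contDiff_qr : ContDiff ℝ ∞ State.qr := by unfold State.qr; fun_prop

@[fun_prop]
theorem State.contDiff_wr : ContDiff ℝ ∞ State.wr := by unfold State.wr; fun_prop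

theorem State.contDiff_q (j : Fin 2) : ContDiff ℝ ∞ (fun s => State.q s j) := by
  unfold State.q; fun_prop

theorem State.contDiff_w (j : Fin 2) : ContDiff ℝ ∞ (fun s => State.w s j) := by
  unfold State.w; fun_prop

theorem contDiff_ex (hR : R.Admissible P) :
    ContDiff ℝ ∞ (fun p : ℝ × State => ex R p.1 p.2) := by
  have := hR.smooth_x
  unfold ex; fun_prop

theorem contDiff_ev (hR : R.Admissible P) :
    ContDiff ℝ ∞ (fun p : ℝ × State => ev R p.1 p.2) := by
  have := hR.contDiff_v
  unfold ev; fun_prop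

theorem contDiff_eqr (hR : R.Admissible P) :
    ContDiff ℝ ∞ (fun p : ℝ × State => eqr R p.1 p.2) := by
  have := hR.smooth_q
  unfold eqr attErr; fun_prop

theorem contDiff_ewr (hR : R.Admissible P) :
    ContDiff ℝ ∞ (fun p : ℝ × State => ewr R p.1 p.2) := by
  have := hR.contDiff_w
  unfold ewr angErr; fun_prop

theorem contDiff_muDes (hR : R.Admissible P) (j : Fin 2) :
    ContDiff ℝ ∞ (fun p : ℝ × State => muDes sigma P R K j p.1 p.2) := by
  have h1 := hR.contDiff_a
  have h2 := hR.contDiff_w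
  have h3 := hR.contDiff_wdot
  have h4 := contDiff_ex hR
  have h5 := contDiff_ev hR
  have h6 := contDiff_eqr hR
  have h7 := contDiff_ewr hR
  have h8 : ContDiff ℝ ∞ (fun p : ℝ × State => inner ℝ (State.qr p.2) (R.w p.1)) :=
    ContDiff.inner ℝ (by fun_prop) (by fun_prop)
  unfold muDes muSum muDiff
  fun_prop

theorem contDiff_mu (hR : R.Admissible P) (j : Fin 2) :
    ContDiff ℝ ∞ (fun p : ℝ × State => mu sigma P R K p.1 p.2 j) := by
  have h1 := contDiff_muDes (sigma := sigma) (K := K) hR j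
  have h2 := State.contDiff_q j
  unfold mu
  fun_prop

theorem contDiff_rodAttAcc (hR : R.Admissible P) :
    ContDiff ℝ ∞ (fun p : ℝ × State => rodAttAcc P (mu sigma P R K p.1 p.2) p.2) := by
  have h1 := fun j => contDiff_mu (sigma := sigma) (K := K) hR j
  have h2 := h1 0
  have h3 := h1 1
  unfold rodAttAcc rodAngAcc
  fun_prop

theorem contDiff_endAcc (hR : R.Admissible P) (j : Fin 2) :
    ContDiff ℝ ∞ (fun p : ℝ × State => endAcc P (mu sigma P R K p.1 p.2) p.2 j) := by
  have h2 := contDiff_mu (sigma := sigma) (K := K) hR 0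
  have h3 := contDiff_mu (sigma := sigma) (K := K) hR 1
  have h4 := contDiff_rodAttAcc (sigma := sigma) (K := K) hR
  unfold endAcc rodAcc
  fun_prop

theorem contDiffAt_reducedField (hR : R.Admissible P) {u : ℝ → State → Fin 2 → V} {p : ℝ × State}
    (hu : ∀ j, ContDiffAt ℝ ∞ (fun p : ℝ × State => u p.1 p.2 j) p) :
    ContDiffAt ℝ ∞ (fun p : ℝ × State =>
      reducedField P (mu sigma P R K p.1 p.2) (u p.1 p.2) p.2) p := by
  have h2 := (contDiff_mu (sigma := sigma) (K := K) hR 0).contDiffAt (x := p)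
  have h3 := (contDiff_mu (sigma := sigma) (K := K) hR 1).contDiffAt (x := p)
  unfold reducedField
  refine ContDiffAt.prodMk ?_ (contDiffAt_pi.2 fun j => ?_)
  · unfold rodAcc rodAngAcc
    have h4 := State.contDiff_vr
    have h5 := State.contDiff_qr
    have h6 := State.contDiff_wr
    refine ContDiffAt.prodMk (by fun_prop) (ContDiffAt.prodMk (by fun_prop)
      (ContDiffAt.prodMk (by fun_prop) (by fun_prop)))
  · have h4 := (contDiff_endAcc (sigma := sigma) (K := K) hR j).contDiffAt (x := p)
    have h5 := State.contDiff_q j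
    have h6 := State.contDiff_w j
    have h7 := hu j
    refine ContDiffAt.prodMk (by fun_prop) (by fun_prop)

theorem contDiffAt_timeDeriv (hR : R.Admissible P) {f : ℝ → State → V} {p : ℝ × State}
    (hf : ContDiffAt ℝ ∞ (fun p : ℝ × State => f p.1 p.2) p) :
    ContDiffAt ℝ ∞ (fun p : ℝ × State => timeDeriv sigma P R K f p.1 p.2) p := by
  have h1 : ContDiffAt ℝ ∞ (fderiv ℝ fun p : ℝ × State => f p.1 p.2) p :=
    hf.fderiv_right (by simp)
  have h2 := contDiffAt_reducedField (sigma := sigma) (K := K) hR (u := fun _ _ => 0) (p := p)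
    (fun j => contDiffAt_const)
  unfold timeDeriv
  exact h1.clm_apply (contDiffAt_const.prodMk h2)

theorem contDiffAt_qDes (hR : R.Admissible P) {j : Fin 2} {p : ℝ × State}
    (h0 : muDes sigma P R K j p.1 p.2 ≠ 0) :
    ContDiffAt ℝ ∞ (fun p : ℝ × State => qDes sigma P R K j p.1 p.2) p := by
  have h1 := (contDiff_muDes (sigma := sigma) (K := K) hR j).contDiffAt (x := p)
  have h2 := (h1.norm ℝ h0).inv (norm_ne_zero_iff.2 h0)
  exact (h2.smul h1).neg

theorem contDiffAt_wDes (hR : R.Admissible P) {j : Fin 2} {p : ℝ × State}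
    (h0 : muDes sigma P R K j p.1 p.2 ≠ 0) :
    ContDiffAt ℝ ∞ (fun p : ℝ × State => wDes sigma P R K j p.1 p.2) p :=
  (contDiffAt_qDes hR h0).hat (contDiffAt_timeDeriv hR (contDiffAt_qDes hR h0))

theorem contDiffAt_closedLoop (hR : R.Admissible P) {p : ℝ × State}
    (h0 : ∀ j, muDes sigma P R K j p.1 p.2 ≠ 0) :
    ContDiffAt ℝ ∞ (fun p : ℝ × State => closedLoop sigma P R K p.1 p.2) p := by
  unfold closedLoop
  refine contDiffAt_reducedField hR (u := fun t s j =>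
    uPar sigma P R K t s j + uPerp sigma P R K t s j) fun j => ?_
  have h1 := contDiffAt_qDes hR (h0 j)
  have h2 := contDiffAt_wDes hR (h0 j)
  have h3 : ContDiffAt ℝ ∞ (fun p : ℝ × State => wDesDot sigma P R K j p.1 p.2) p :=
    contDiffAt_timeDeriv hR h2
  have h4 := (contDiff_endAcc (sigma := sigma) (K := K) hR j).contDiffAt (x := p)
  have h5 : ContDiffAt ℝ ∞ (fun p : ℝ × State => State.q p.2 j) p :=
    ((State.contDiff_q j).comp contDiff_snd).contDiffAt
  have h6 : ContDiffAt ℝ ∞ (fun p : ℝ × State => State.w p.2 j) p :=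
    ((State.contDiff_w j).comp contDiff_snd).contDiffAt
  have h7 := (contDiff_mu (sigma := sigma) (K := K) hR j).contDiffAt (x := p)
  have h8 := h5.inner ℝ h4
  have h9 := h5.inner ℝ h2
  have h10 := h6.norm_sq ℝ
  unfold uPar uPerp eqj ewj attErr angErr
  fun_prop

end Smoothness

/-! ### Total time derivatives -/

section TimeDerivative

variable {sigma : ℝ} {P : Params} {R : Reference} {K : Gains}

/-- A derivative vanishes in a direction along which the function is constant. -/
theorem fderiv_apply_eq_zero_of_invariant {G F : Type*} [NormedAddCommGroup G] [NormedSpace ℝ G]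
    [NormedAddCommGroup F] [NormedSpace ℝ F] {f : G → F} {p v : G}
    (h : ∀ r : ℝ, f (p + r • v) = f p) : fderiv ℝ f p v = 0 := by
  by_cases hf : DifferentiableAt ℝ f p
  · rw [← hf.lineDeriv_eq_fderiv, lineDeriv]
    simp [h]
  -- Without differentiability `fderiv` takes its default value `0`, so no regularity is needed;
  -- `timeDeriv_congr` relies on this.
  · simp [fderiv_zero_of_not_differentiableAt hf]

/-- The true field and the one with zero thrust differ only in the `ω_j` components, and `f` is
constant in those directions. This justifies the zero thrust in `timeDeriv`. -/
theorem hasDerivWithinAt_timeDeriv {f : ℝ → State → V} {s : ℝ → State} {I : Set ℝ} {t : ℝ}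
    (hf : DifferentiableAt ℝ (fun p : ℝ × State => f p.1 p.2) (t, s t))
    (hind : ∀ (t : ℝ) (s s' : State), s.1 = s'.1 → (∀ j, State.q s j = State.q s' j) →
      f t s = f t s')
    (hs : HasDerivWithinAt s (closedLoop sigma P R K t (s t)) I t) :
    HasDerivWithinAt (fun t => f t (s t)) (timeDeriv sigma P R K f t (s t)) I t := by
  have h1 : HasDerivWithinAt (fun t => (t, s t)) (1, closedLoop sigma P R K t (s t)) I t :=
    (hasDerivWithinAt_id t I).prodMk hs
  refine (hf.hasFDerivAt.comp_hasDerivWithinAt t h1).congr_deriv ?_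
  rw [timeDeriv, ← sub_eq_zero, ← map_sub]
  refine fderiv_apply_eq_zero_of_invariant fun r => ?_
  have ht : (((1 : ℝ), closedLoop sigma P R K t (s t)) -
      (1, reducedField P (mu sigma P R K t (s t)) 0 (s t))).1 = 0 := by simp
  simp only [Prod.fst_add, Prod.smul_fst, ht, Prod.snd_add, Prod.smul_snd]
  rw [smul_zero, add_zero]
  apply hind
  · simp [closedLoop, reducedField]
  · intro j
    simp [closedLoop, reducedField, State.q]

theorem muDes_congr {j : Fin 2} {t : ℝ} {s s' : State} (h : s.1 = s'.1) :
    muDes sigma P R K j t s = muDes sigma P R K j t s' := by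
  simp only [muDes, muSum, muDiff, ev, ex, eqr, ewr, State.xr, State.vr, State.qr, State.wr, h]

theorem qDes_congr {j : Fin 2} {t : ℝ} {s s' : State} (h : s.1 = s'.1) :
    qDes sigma P R K j t s = qDes sigma P R K j t s' := by
  rw [qDes, qDes, muDes_congr h]

theorem mu_congr {t : ℝ} {s s' : State} (h : s.1 = s'.1)
    (hq : ∀ j, State.q s j = State.q s' j) : mu sigma P R K t s = mu sigma P R K t s' := by
  funext j
  rw [mu, mu, muDes_congr h, hq]

/-- Since `f` ignores the cable variables, its differential is invariant under translations in them.
The cables enter only through `μ_j` in the rod part of the field, hence through `q_j` and not `ω_j`.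
-/
theorem timeDeriv_congr {f : ℝ → State → V}
    (hind : ∀ (t : ℝ) (s s' : State), s.1 = s'.1 → f t s = f t s') {t : ℝ} {s s' : State}
    (h : s.1 = s'.1) (hq : ∀ j, State.q s j = State.q s' j) :
    timeDeriv sigma P R K f t s = timeDeriv sigma P R K f t s' := by
  have h1 : fderiv ℝ (fun p : ℝ × State => f p.1 p.2) (t, s) =
      fderiv ℝ (fun p : ℝ × State => f p.1 p.2) (t, s') := by
    have h2 : (fun p : ℝ × State => f p.1 p.2) =
        fun p => (fun p : ℝ × State => f p.1 p.2) (p + (0, (0, s'.2 - s.2))) := by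
      funext p
      have h3 : (p + ((0 : ℝ), ((0 : V × V × V × V), s'.2 - s.2))).1 = p.1 := by simp
      simp only [h3]
      exact hind _ _ _ (by simp)
    have h4 : (t, s) + ((0 : ℝ), ((0 : V × V × V × V), s'.2 - s.2)) = (t, s') := by
      refine Prod.ext (by simp) (Prod.ext (by simpa using h) (by simp))
    rw [← h4, ← fderiv_comp_add_right, ← h2]
  rw [timeDeriv, timeDeriv, h1, ← sub_eq_zero, ← map_sub]
  refine fderiv_apply_eq_zero_of_invariant fun r => ?_
  have hF : (reducedField P (mu sigma P R K t s) 0 s).1 =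
      (reducedField P (mu sigma P R K t s') 0 s').1 := by
    rw [mu_congr h hq]
    simp only [reducedField, rodAngAcc, State.vr, State.qr, State.wr, h]
  have ht : (((1 : ℝ), reducedField P (mu sigma P R K t s) 0 s) -
      (1, reducedField P (mu sigma P R K t s') 0 s')).1 = 0 := by simp
  simp only [Prod.fst_add, Prod.smul_fst, ht, Prod.snd_add, Prod.smul_snd]
  rw [smul_zero, add_zero]
  exact hind _ _ _ (by simp [hF])

theorem wDes_congr {j : Fin 2} {t : ℝ} {s s' : State} (h : s.1 = s'.1)
    (hq : ∀ j, State.q s j = State.q s' j) :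
    wDes sigma P R K j t s = wDes sigma P R K j t s' := by
  rw [wDes, wDes, qDes_congr h, timeDeriv_congr (f := qDes sigma P R K j) (fun _ _ _ => qDes_congr) h hq]

theorem norm_qDes {j : Fin 2} {t : ℝ} {s : State} (h0 : muDes sigma P R K j t s ≠ 0) :
    ‖qDes sigma P R K j t s‖ = 1 := by
  rw [qDes, norm_neg, norm_smul, norm_inv, norm_norm, inv_mul_cancel₀ (norm_ne_zero_iff.2 h0)]

theorem muDes_eq {j : Fin 2} {t : ℝ} {s : State} :
    muDes sigma P R K j t s = -(‖muDes sigma P R K j t s‖ • qDes sigma P R K j t s) := by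
  by_cases h0 : muDes sigma P R K j t s = 0
  · simp [h0]
  rw [qDes, smul_neg, neg_neg, smul_smul, mul_inv_cancel₀ (norm_ne_zero_iff.2 h0), one_smul]

/-- The norm of `qDes` is constantly `1` near a point where the desired force is nonzero, so the
differential of its square vanishes in every direction. -/
theorem inner_qDes_timeDeriv (hR : R.Admissible P) {j : Fin 2} {t : ℝ} {s : State}
    (h0 : muDes sigma P R K j t s ≠ 0) :
    inner ℝ (qDes sigma P R K j t s)
      (timeDeriv sigma P R K (qDes sigma P R K j) t s) = 0 := by
  have hd : DifferentiableAt ℝ (fun p : ℝ × State => qDes sigma P R K j p.1 p.2) (t, s) :=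
    (contDiffAt_qDes (p := (t, s)) hR h0).differentiableAt (by simp)
  have h1 := hd.hasFDerivAt.norm_sq
  have hev : ∀ᶠ p : ℝ × State in nhds (t, s), muDes sigma P R K j p.1 p.2 ≠ 0 :=
    (contDiff_muDes hR j).continuous.continuousAt.eventually_ne h0
  have h2 : (fun p : ℝ × State => ‖qDes sigma P R K j p.1 p.2‖ ^ 2) =ᶠ[nhds (t, s)]
      fun _ => (1 : ℝ) := by
    filter_upwards [hev] with p hp
    rw [norm_qDes hp, one_pow]
  have h3 := h1.unique ((hasFDerivAt_const (1 : ℝ) (t, s)).congr_of_eventuallyEq h2)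
  have h4 := congrArg
    (fun L : ℝ × State →L[ℝ] ℝ => L (1, reducedField P (mu sigma P R K t s) 0 s)) h3
  simpa [timeDeriv] using h4

theorem inner_qDes_wDes {j : Fin 2} {t : ℝ} {s : State} :
    inner ℝ (qDes sigma P R K j t s) (wDes sigma P R K j t s) = 0 :=
  inner_hat_left _ _

theorem hat_wDes_qDes (hR : R.Admissible P) {j : Fin 2} {t : ℝ} {s : State}
    (h0 : muDes sigma P R K j t s ≠ 0) :
    hat (wDes sigma P R K j t s) (qDes sigma P R K j t s) =
      timeDeriv sigma P R K (qDes sigma P R K j) t s := by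
  rw [wDes, hat_anticomm, hat_hat_of_orthogonal (norm_qDes h0) (inner_qDes_timeDeriv hR h0),
    neg_neg]

theorem Reference.Admissible.inner_q_deriv (hR : R.Admissible P) (t : ℝ) :
    inner ℝ (R.q t) (deriv R.q t) = 0 := by
  have hd : DifferentiableAt ℝ R.q t := hR.smooth_q.differentiable (by simp) t
  have h1 := hd.hasDerivAt.norm_sq
  have h2 : (fun t => ‖R.q t‖ ^ 2) = fun _ => (1 : ℝ) := by
    funext t; rw [hR.unit_q, one_pow]
  rw [h2] at h1
  have := h1.unique (hasDerivAt_const t (1 : ℝ))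
  linarith

theorem Reference.Admissible.hasDerivAt_q (hR : R.Admissible P) (t : ℝ) :
    HasDerivAt R.q (hat (R.w t) (R.q t)) t := by
  rw [Reference.w, hat_anticomm, hat_hat_of_orthogonal (hR.unit_q t) (hR.inner_q_deriv t), neg_neg]
  exact (hR.smooth_q.differentiable (by simp) t).hasDerivAt

theorem Reference.inner_q_w (R : Reference) (t : ℝ) : inner ℝ (R.q t) (R.w t) = 0 :=
  inner_hat_left _ _

end TimeDerivative

/-! ### Error dynamics -/

section ErrorDynamics

variable {sigma : ℝ} {P : Params} {R : Reference} {K : Gains} {t : ℝ} {s : State}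

theorem Params.Ir_pos (P : Params) : 0 < P.Ir := by
  have := P.mr_pos
  have := P.Lr_pos
  unfold Params.Ir; positivity

/-- The force error `μ_j - μ̃_j`. -/
noncomputable def forceErr (sigma : ℝ) (P : Params) (R : Reference) (K : Gains) (t : ℝ) (s : State)
    (j : Fin 2) : V :=
  hat (State.q s j) (hat (State.q s j) (muDes sigma P R K j t s))

theorem mu_eq_muDes_add (j : Fin 2) :
    mu sigma P R K t s j = muDes sigma P R K j t s + forceErr sigma P R K t s j := rfl

/-- Since `μ̃_j` is antiparallel to `q̃_j`, `‖q_j × μ̃_j‖` is `‖μ̃_j‖` times the attitude error.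
This is the only coupling from the cables to the rod. -/
theorem norm_forceErr_le {j : Fin 2} (hq : ‖State.q s j‖ = 1) :
    ‖forceErr sigma P R K t s j‖ ≤
      ‖muDes sigma P R K j t s‖ * ‖eqj sigma P R K j t s‖ := by
  have h1 : ‖hat (State.q s j) (muDes sigma P R K j t s)‖ =
      ‖muDes sigma P R K j t s‖ * ‖eqj sigma P R K j t s‖ := by
    conv_lhs => rw [muDes_eq, hat_neg_right, hat_smul_right, hat_anticomm]
    rw [norm_neg, norm_smul, norm_neg, norm_norm, eqj, attErr]
  refine (norm_hat_le _ _).trans ?_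
  rw [hq, one_mul, h1]

theorem muDes_zero_add_one :
    muDes sigma P R K 0 t s + muDes sigma P R K 1 t s = muSum P R K t s := by
  simp only [muDes, sgn]
  norm_num
  module

theorem muDes_one_sub_zero :
    muDes sigma P R K 1 t s - muDes sigma P R K 0 t s = muDiff sigma P R K t s := by
  simp only [muDes, sgn]
  norm_num
  module

theorem rodAcc_mu :
    rodAcc P (mu sigma P R K t s) = R.a t - K.kv • ev R t s - K.kx • ex R t s
      + (1 / P.mr) • (forceErr sigma P R K t s 0 + forceErr sigma P R K t s 1) := by
  have h1 : mu sigma P R K t s 0 + mu sigma P R K t s 1 = muSum P R K t s +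
      (forceErr sigma P R K t s 0 + forceErr sigma P R K t s 1) := by
    rw [mu_eq_muDes_add, mu_eq_muDes_add, ← muDes_zero_add_one (sigma := sigma)]; abel
  rw [rodAcc, h1, smul_add, muSum, smul_smul, one_div_mul_cancel P.mr_pos.ne']
  module

/-- The disturbance in the equation of the angular velocity error of the rod. -/
noncomputable def rodDist (sigma : ℝ) (P : Params) (R : Reference) (K : Gains) (t : ℝ)
    (s : State) : V :=
  -((1 + sigma) • inner ℝ (State.qr s) (R.w t) • hat (State.qr s) (State.wr s))
    + (1 / P.Ir) • hat (State.qr s) (forceErr sigma P R K t s 1 - forceErr sigma P R K t s 0)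

/-- On the orthogonal complement of `q_r` the square of the hat map is `-1`, so the control yields
the form required by `hasDerivWithinAt_attLyap`, up to `rodDist`. The drift part of `rodDist` has
the factor `1 + sigma`. -/
theorem rodAngAcc_mu (hs : OnPhaseSpace s) :
    rodAngAcc P (mu sigma P R K t s) s =
      -hat (State.qr s) (hat (State.qr s) (R.wdot t))
      + inner ℝ (State.qr s) (R.w t) • hat (State.qr s) (State.wr s)
      - K.kqr • attErr (R.q t) (State.qr s) - K.kwr • angErr (State.qr s) (State.wr s) (R.w t)
      + rodDist sigma P R K t s := by
  have h1 : mu sigma P R K t s 1 - mu sigma P R K t s 0 = muDiff sigma P R K t s +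
      (forceErr sigma P R K t s 1 - forceErr sigma P R K t s 0) := by
    rw [mu_eq_muDes_add, mu_eq_muDes_add, ← muDes_one_sub_zero (sigma := sigma)]; abel
  have hq := hs.unit_qr
  have he : inner ℝ (State.qr s) (angErr (State.qr s) (State.wr s) (R.w t)) = 0 :=
    inner_angErr hs.orth_wr _
  have ha : inner ℝ (State.qr s) (attErr (R.q t) (State.qr s)) = 0 := inner_hat_right _ _
  have hw : hat (State.qr s) (hat (State.qr s) (hat (State.qr s) (R.w t))) =
      hat (State.qr s) (angErr (State.qr s) (State.wr s) (R.w t))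
        - hat (State.qr s) (State.wr s) := by
    rw [angErr, hat_add_right]; abel
  rw [rodAngAcc, h1, hat_add_right, smul_add, muDiff, hat_smul_right, smul_smul,
    one_div_mul_cancel P.Ir_pos.ne', one_smul, rodDist]
  simp only [eqr, ewr, hat_add_right, hat_sub_right, hat_smul_right, hat_neg_right,
    hat_hat_of_orthogonal hq he, hat_hat_of_orthogonal hq ha, hw]
  module

/-- The parallel thrust is a multiple of `q_j` and has no torque; the orthogonal thrust cancels the
acceleration of the attachment point. The result is the attitude feedback with zero disturbance. -/
theorem closedLoop_cable (hs : OnPhaseSpace s) (j : Fin 2) :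
    ((closedLoop sigma P R K t s).2 j).2 =
      -hat (State.q s j) (hat (State.q s j) (wDesDot sigma P R K j t s))
      + inner ℝ (State.q s j) (wDes sigma P R K j t s) • hat (State.q s j) (State.w s j)
      - K.kq j • attErr (qDes sigma P R K j t s) (State.q s j)
      - K.kw j • angErr (State.q s j) (State.w s j) (wDes sigma P R K j t s) := by
  have hq := hs.unit_q j
  have he : inner ℝ (State.q s j)
      (angErr (State.q s j) (State.w s j) (wDes sigma P R K j t s)) = 0 :=
    inner_angErr (hs.orth_w j) _
  have ha : inner ℝ (State.q s j) (attErr (qDes sigma P R K j t s) (State.q s j)) = 0 :=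
    inner_hat_right _ _
  have hpar : hat (State.q s j) (uPar sigma P R K t s j) = 0 := by
    rw [uPar, mu, hat_hat_self hq]
    simp only [hat_add_right, hat_sub_right, hat_smul_right, hat_self, smul_zero, zero_sub,
      add_zero]
    abel
  have h3 : ∀ z : V, hat (State.q s j) (hat (State.q s j) (hat (State.q s j) z)) =
      -hat (State.q s j) z := fun z => hat_hat_of_orthogonal hq (inner_hat_left _ _)
  have hm := P.mQ_pos.ne'
  have hL := P.Lc_pos.ne'
  simp only [closedLoop, reducedField, hat_add_right (State.q s j) (uPar sigma P R K t s j), hpar,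
    zero_add, uPerp, eqj, ewj]
  simp only [hat_add_right, hat_sub_right, hat_smul_right, hat_neg_right, h3,
    hat_hat_of_orthogonal hq he, hat_hat_of_orthogonal hq ha]
  match_scalars <;> field_simp
  ring

end ErrorDynamics

/-! ### Uniform bounds near the reference -/

section Bounds

/-- `f` is differentiable at `t`, with value and derivative bounded by `b` and `d`. -/
def BoundedDeriv {G : Type*} [NormedAddCommGroup G] [NormedSpace ℝ G] (f : ℝ → G) (t b d : ℝ) :
    Prop :=
  ∃ f', HasDerivAt f f' t ∧ ‖f t‖ ≤ b ∧ ‖f'‖ ≤ d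

namespace BoundedDeriv

variable {G : Type*} [NormedAddCommGroup G] [NormedSpace ℝ G] {t b d b' d' : ℝ}

theorem const (c : G) : BoundedDeriv (fun _ => c) t ‖c‖ 0 :=
  ⟨0, hasDerivAt_const t c, le_rfl, by simp⟩

theorem add {f g : ℝ → G} (hf : BoundedDeriv f t b d) (hg : BoundedDeriv g t b' d') :
    BoundedDeriv (fun t => f t + g t) t (b + b') (d + d') := by
  obtain ⟨f', hf, h1, h2⟩ := hf
  obtain ⟨g', hg, h3, h4⟩ := hg
  exact ⟨_, hf.add hg, norm_add_le_of_le h1 h3, norm_add_le_of_le h2 h4⟩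

theorem neg {f : ℝ → G} (hf : BoundedDeriv f t b d) :
    BoundedDeriv (fun t => -f t) t b d := by
  obtain ⟨f', hf, h1, h2⟩ := hf
  exact ⟨_, hf.neg, by rwa [norm_neg], by rwa [norm_neg]⟩

theorem sub {f g : ℝ → G} (hf : BoundedDeriv f t b d) (hg : BoundedDeriv g t b' d') :
    BoundedDeriv (fun t => f t - g t) t (b + b') (d + d') := by
  simpa only [sub_eq_add_neg] using hf.add hg.neg

theorem const_smul {f : ℝ → G} (r : ℝ) (hf : BoundedDeriv f t b d) :
    BoundedDeriv (fun t => r • f t) t (|r| * b) (|r| * d) := by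
  obtain ⟨f', hf, h1, h2⟩ := hf
  refine ⟨_, hf.const_smul r, ?_, ?_⟩ <;> rw [norm_smul, Real.norm_eq_abs] <;> gcongr

theorem smul {c : ℝ → ℝ} {f : ℝ → G} (hc : BoundedDeriv c t b d) (hf : BoundedDeriv f t b' d') :
    BoundedDeriv (fun t => c t • f t) t (b * b') (b * d' + d * b') := by
  obtain ⟨c', hc, h1, h2⟩ := hc
  obtain ⟨f', hf, h3, h4⟩ := hf
  have hb : 0 ≤ b := (norm_nonneg _).trans h1
  have hd : 0 ≤ d := (norm_nonneg _).trans h2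
  refine ⟨_, hc.smul hf, ?_, norm_add_le_of_le ?_ ?_⟩ <;> rw [norm_smul] <;> gcongr

theorem hat {f g : ℝ → V} (hf : BoundedDeriv f t b d) (hg : BoundedDeriv g t b' d') :
    BoundedDeriv (fun t => hat (f t) (g t)) t (b * b') (d * b' + b * d') := by
  obtain ⟨f', hf, h1, h2⟩ := hf
  obtain ⟨g', hg, h3, h4⟩ := hg
  have hb : 0 ≤ b := (norm_nonneg _).trans h1
  have hd : 0 ≤ d := (norm_nonneg _).trans h2
  refine ⟨_, (hf.hasDerivWithinAt.hat hg.hasDerivWithinAt).hasDerivAt Filter.univ_mem, ?_,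
    norm_add_le_of_le ?_ ?_⟩ <;> refine (norm_hat_le _ _).trans ?_ <;> gcongr

theorem inner {f g : ℝ → V} (hf : BoundedDeriv f t b d) (hg : BoundedDeriv g t b' d') :
    BoundedDeriv (fun t => inner ℝ (f t) (g t)) t (b * b') (b * d' + d * b') := by
  obtain ⟨f', hf, h1, h2⟩ := hf
  obtain ⟨g', hg, h3, h4⟩ := hg
  have hb : 0 ≤ b := (norm_nonneg _).trans h1
  have hd : 0 ≤ d := (norm_nonneg _).trans h2
  refine ⟨_, hf.inner ℝ hg, ?_, norm_add_le_of_le ?_ ?_⟩ <;>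
    refine (abs_real_inner_le_norm _ _).trans ?_ <;> gcongr

end BoundedDeriv

/-- Bounds on the reference signals for nonnegative times. -/
structure Reference.BoundedBy (R : Reference) (B : ℝ) : Prop where
  nonneg : 0 ≤ B
  a : ∀ t, 0 ≤ t → BoundedDeriv R.a t B B
  q : ∀ t, 0 ≤ t → BoundedDeriv R.q t 1 B
  w : ∀ t, 0 ≤ t → BoundedDeriv R.w t B B
  wdot : ∀ t, 0 ≤ t → BoundedDeriv R.wdot t B B

/-- As `q̃' × q̃' = 0`, the angular acceleration is `q̃ × q̃''`, so three derivatives of `q̃` also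
control the derivative of `wdot`. -/
theorem Reference.Admissible.exists_boundedBy {P : Params} {R : Reference}
    (hR : R.Admissible P) : ∃ B, R.BoundedBy B := by
  obtain ⟨B₁, h₁⟩ := hR.bounded_x
  obtain ⟨B₂, h₂⟩ := hR.bounded_q
  have ha : R.a = iteratedDeriv 2 R.x := by
    rw [iteratedDeriv_succ, iteratedDeriv_one]; rfl
  have ha' : deriv R.a = iteratedDeriv 3 R.x := by
    rw [iteratedDeriv_succ, ha]
  have hq2 : deriv (deriv R.q) = iteratedDeriv 2 R.q := by
    rw [iteratedDeriv_succ, iteratedDeriv_one]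
  have hq3 : deriv (deriv (deriv R.q)) = iteratedDeriv 3 R.q := by
    rw [iteratedDeriv_succ, hq2]
  have hd1 : ∀ t, HasDerivAt R.q (deriv R.q t) t := fun t =>
    (hR.smooth_q.differentiable (by simp) t).hasDerivAt
  have hd2 : ∀ t, HasDerivAt (deriv R.q) (deriv (deriv R.q) t) t := fun t =>
    (hR.contDiff_deriv_q.differentiable (by simp) t).hasDerivAt
  have hd3 : ∀ t, HasDerivAt (deriv (deriv R.q)) (deriv (deriv (deriv R.q)) t) t := fun t =>
    ((contDiff_infty_iff_deriv.1 hR.contDiff_deriv_q).2.differentiable (by simp) t).hasDerivAt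
  have hw : ∀ t, HasDerivAt R.w (hat (R.q t) (deriv (deriv R.q) t)) t := fun t => by
    have := ((hd1 t).hasDerivWithinAt.hat (hd2 t).hasDerivWithinAt).hasDerivAt Filter.univ_mem
    rw [hat_self, zero_add] at this
    exact this
  have hwdot : R.wdot = fun t => hat (R.q t) (deriv (deriv R.q) t) := funext fun t => (hw t).deriv
  have b1 : ∀ t, 0 ≤ t → ‖deriv R.q t‖ ≤ B₂ := fun t ht => by
    simpa using h₂ t ht 1 (by simp)
  have b2 : ∀ t, 0 ≤ t → ‖deriv (deriv R.q) t‖ ≤ B₂ := fun t ht => by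
    rw [hq2]; exact h₂ t ht 2 (by simp)
  have b3 : ∀ t, 0 ≤ t → ‖deriv (deriv (deriv R.q)) t‖ ≤ B₂ := fun t ht => by
    rw [hq3]; exact h₂ t ht 3 (by simp)
  have hB₁ : 0 ≤ B₁ := (norm_nonneg _).trans (h₁ 0 le_rfl 2 (by simp))
  have hB₂ : 0 ≤ B₂ := (norm_nonneg _).trans (b1 0 le_rfl)
  have hq : ∀ t, 0 ≤ t → BoundedDeriv R.q t 1 B₂ := fun t ht =>
    ⟨_, hd1 t, (hR.unit_q t).le, b1 t ht⟩
  have hq' : ∀ t, 0 ≤ t → BoundedDeriv (deriv R.q) t B₂ B₂ := fun t ht =>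
    ⟨_, hd2 t, b1 t ht, b2 t ht⟩
  have hq'' : ∀ t, 0 ≤ t → BoundedDeriv (deriv (deriv R.q)) t B₂ B₂ := fun t ht =>
    ⟨_, hd3 t, b2 t ht, b3 t ht⟩
  have mono : ∀ {f : ℝ → V} {t b d b' d' : ℝ}, BoundedDeriv f t b d → b ≤ b' → d ≤ d' →
      BoundedDeriv f t b' d' := fun ⟨f', h1, h2, h3⟩ hb hd => ⟨f', h1, h2.trans hb, h3.trans hd⟩
  refine ⟨B₁ + B₂ + B₂ * B₂, by positivity, fun t ht => ?_, fun t ht => ?_, fun t ht => ?_,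
    fun t ht => ?_⟩
  · refine mono ⟨_, (hR.contDiff_a.differentiable (by simp) t).hasDerivAt, ?_, ?_⟩
      (show B₁ ≤ _ by nlinarith) (show B₁ ≤ _ by nlinarith)
    · rw [ha]; exact h₁ t ht 2 (by simp)
    · rw [ha']; exact h₁ t ht 3 (by simp)
  · exact mono (hq t ht) le_rfl (by nlinarith)
  · exact mono ((hq t ht).hat (hq' t ht)) (by nlinarith) (by nlinarith)
  · rw [hwdot]
    exact mono ((hq t ht).hat (hq'' t ht)) (by nlinarith) (by nlinarith)

/-- The rod is within distance `r` of its reference. -/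
structure NearReference (R : Reference) (r t : ℝ) (s : State) : Prop where
  phase : OnPhaseSpace s
  ex_le : ‖ex R t s‖ ≤ r
  ev_le : ‖ev R t s‖ ≤ r
  q_le : ‖State.qr s - R.q t‖ ≤ r
  ewr_le : ‖ewr R t s‖ ≤ r

variable {sigma : ℝ} {P : Params} {R : Reference} {B : ℝ}

theorem NearReference.norm_wr_le {r t : ℝ} {s : State} (hB : R.BoundedBy B)
    (hs : NearReference R r t s) (hr : r ≤ 1) (ht : 0 ≤ t) : ‖State.wr s‖ ≤ B + 1 := by
  obtain ⟨-, -, hw, -⟩ := hB.w t ht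
  have h1 := norm_le_norm_angErr_add (w := State.wr s) (z := R.w t) hs.phase.unit_qr
  have h2 := hs.ewr_le
  rw [ewr] at h2
  linarith

/-- The difference consists of gain terms, linear in the errors, of the attitude mismatch in the
`wdot` term, and of the drift terms, small because `q̃_r` is orthogonal to `ω̃_r`. -/
theorem norm_muDes_sub_nominal_le (K : Gains) (hR : R.Admissible P) (hB : R.BoundedBy B)
    (hsigma : |sigma| = 1) :
    ∃ C, 0 ≤ C ∧ ∀ r t s, r ≤ 1 → 0 ≤ t → NearReference R r t s → ∀ j,
      ‖muDes sigma P R K j t s - nominalForce P R j t‖ ≤ C * r := by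
  have hm := P.mr_pos
  have hI := P.Ir_pos
  have hB0 := hB.nonneg
  refine ⟨1 / 2 * (P.mr * (|K.kv| + |K.kx|) + P.Ir * (B + (B * B + B) + |K.kwr| + |K.kqr|)),
    by positivity, fun r t s hr1 ht hs j => ?_⟩
  have hr : 0 ≤ r := (norm_nonneg _).trans hs.ex_le
  have hq := hs.phase.unit_qr
  obtain ⟨-, -, hw, -⟩ := hB.w t ht
  obtain ⟨-, -, hwd, -⟩ := hB.wdot t ht
  have hsgn : |sgn j| = 1 := by simp [sgn, abs_pow]
  have hqw : |inner ℝ (State.qr s) (R.w t)| ≤ r * B := by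
    have : inner ℝ (State.qr s) (R.w t) = inner ℝ (State.qr s - R.q t) (R.w t) := by
      rw [inner_sub_left, R.inner_q_w, sub_zero]
    rw [this]
    refine (abs_real_inner_le_norm _ _).trans ?_
    have := hs.q_le
    gcongr
  have heq : ‖eqr R t s‖ ≤ r := by
    have h1 : eqr R t s = hat (R.q t) (State.qr s - R.q t) := by
      rw [hat_sub_right, hat_self, sub_zero]; rfl
    rw [h1]
    refine (norm_hat_le _ _).trans ?_
    rw [hR.unit_q, one_mul]
    exact hs.q_le
  have hhat : ∀ z : V, ‖hat (State.qr s) z‖ ≤ ‖z‖ := fun z => by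
    simpa [hq] using norm_hat_le (State.qr s) z
  have hkey : muDes sigma P R K j t s - nominalForce P R j t =
      (1 / 2 : ℝ) • (P.mr • (-(K.kv • ev R t s) - K.kx • ex R t s)
        + sgn j • P.Ir • (-hat (State.qr s - R.q t) (R.wdot t)
          + sigma • (inner ℝ (State.qr s) (R.w t) •
              (hat (State.qr s) (hat (State.qr s) (R.w t)) - ewr R t s))
          + K.kwr • hat (State.qr s) (ewr R t s) + K.kqr • hat (State.qr s) (eqr R t s))) := by
    rw [muDes, nominalForce, muSum, muDiff, hat_sub_left]
    module
  have h1 : ‖P.mr • (-(K.kv • ev R t s) - K.kx • ex R t s)‖ ≤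
      P.mr * (|K.kv| * r + |K.kx| * r) := by
    rw [norm_smul, Real.norm_of_nonneg hm.le]
    gcongr
    refine norm_sub_le_of_le ?_ ?_
    · rw [norm_neg, norm_smul, Real.norm_eq_abs]
      exact mul_le_mul_of_nonneg_left hs.ev_le (abs_nonneg _)
    · rw [norm_smul, Real.norm_eq_abs]
      exact mul_le_mul_of_nonneg_left hs.ex_le (abs_nonneg _)
  have h2 : ‖-hat (State.qr s - R.q t) (R.wdot t)‖ ≤ r * B := by
    rw [norm_neg]
    refine (norm_hat_le _ _).trans ?_
    have := hs.q_le
    gcongr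
  have h3 : ‖sigma • (inner ℝ (State.qr s) (R.w t) •
      (hat (State.qr s) (hat (State.qr s) (R.w t)) - ewr R t s))‖ ≤ r * B * (B + 1) := by
    rw [norm_smul, Real.norm_eq_abs, hsigma, one_mul, norm_smul, Real.norm_eq_abs]
    gcongr
    exact norm_sub_le_of_le ((hhat _).trans ((hhat _).trans hw)) (hs.ewr_le.trans hr1)
  have h4 : ‖K.kwr • hat (State.qr s) (ewr R t s)‖ ≤ |K.kwr| * r := by
    rw [norm_smul, Real.norm_eq_abs]
    gcongr
    exact (hhat _).trans hs.ewr_le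
  have h5 : ‖K.kqr • hat (State.qr s) (eqr R t s)‖ ≤ |K.kqr| * r := by
    rw [norm_smul, Real.norm_eq_abs]
    gcongr
    exact (hhat _).trans heq
  have h6 := norm_add_le_of_le (norm_add_le_of_le (norm_add_le_of_le h2 h3) h4) h5
  rw [hkey, norm_smul, Real.norm_of_nonneg (by norm_num : (0 : ℝ) ≤ 1 / 2), mul_assoc]
  refine mul_le_mul_of_nonneg_left ?_ (by norm_num)
  refine (norm_add_le_of_le h1 (?_ : _ ≤ P.Ir * (r * B + r * B * (B + 1) + |K.kwr| * r
    + |K.kqr| * r))).trans (le_of_eq (by ring))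
  rw [norm_smul, Real.norm_eq_abs, hsgn, one_mul, norm_smul, Real.norm_of_nonneg hI.le]
  exact mul_le_mul_of_nonneg_left h6 hI.le

theorem norm_nominalForce_le (hR : R.Admissible P) (hB : R.BoundedBy B) {t : ℝ} (ht : 0 ≤ t)
    (j : Fin 2) : ‖nominalForce P R j t‖ ≤ P.mr * (B + P.g) + P.Ir * B := by
  have hm := P.mr_pos
  have hI := P.Ir_pos
  have hg := P.g_pos
  have hB0 := hB.nonneg
  obtain ⟨-, -, ha, -⟩ := hB.a t ht
  obtain ⟨-, -, hwd, -⟩ := hB.wdot t ht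
  have hsgn : |sgn j| = 1 := by simp [sgn, abs_pow]
  have he3 : ‖e3‖ = 1 := by
    simp [e3, EuclideanSpace.norm_eq, Fin.sum_univ_three]
  have h1 : ‖P.mr • (R.a t + P.g • e3)‖ ≤ P.mr * (B + P.g) := by
    rw [norm_smul, Real.norm_of_nonneg hm.le]
    gcongr
    refine norm_add_le_of_le ha ?_
    rw [norm_smul, he3, Real.norm_of_nonneg hg.le, mul_one]
  have h2 : ‖sgn j • P.Ir • hat (R.q t) (R.wdot t)‖ ≤ P.Ir * B := by
    rw [norm_smul, Real.norm_eq_abs, hsgn, one_mul, norm_smul, Real.norm_of_nonneg hI.le]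
    gcongr
    refine (norm_hat_le _ _).trans ?_
    rwa [hR.unit_q, one_mul]
  rw [nominalForce, norm_smul, Real.norm_of_nonneg (by norm_num : (0 : ℝ) ≤ 1 / 2)]
  have h3 := norm_sub_le_of_le h1 h2
  have : 0 ≤ P.mr * (B + P.g) + P.Ir * B := by positivity
  linarith

/-- Near the reference the desired forces are bounded, and bounded away from zero. -/
theorem exists_norm_muDes_bounds (K : Gains) (hR : R.Admissible P) (hB : R.BoundedBy B)
    (hsigma : |sigma| = 1) :
    ∃ r c M : ℝ, 0 < r ∧ r ≤ 1 ∧ 0 < c ∧ 0 < M ∧ ∀ t s, 0 ≤ t → NearReference R r t s → ∀ j,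
      c ≤ ‖muDes sigma P R K j t s‖ ∧ ‖muDes sigma P R K j t s‖ ≤ M := by
  obtain ⟨C, hC0, hC⟩ := norm_muDes_sub_nominal_le K hR hB hsigma
  obtain ⟨c, hc, hnom⟩ := hR.nominal_ne_zero
  have hm := P.mr_pos
  have hI := P.Ir_pos
  have hg := P.g_pos
  have hB0 := hB.nonneg
  have hC1 : 0 < C + 1 := by positivity
  -- With this radius the desired force moves by at most half of the nominal lower bound; `C + 1`
  -- avoids dividing by zero.
  set r := min 1 (c / (2 * (C + 1))) with hr
  have hr0 : 0 < r := lt_min one_pos (by positivity)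
  have hr1 : r ≤ 1 := min_le_left _ _
  have hCr : C * r ≤ c / 2 := by
    have h1 : r ≤ c / (2 * (C + 1)) := min_le_right _ _
    rw [le_div_iff₀ (by positivity)] at h1
    nlinarith
  refine ⟨r, c / 2, P.mr * (B + P.g) + P.Ir * B + C, hr0, hr1, by positivity, by positivity,
    fun t s ht hs j => ?_⟩
  have h1 := hC r t s hr1 ht hs j
  have h2 := hnom t ht j
  have h3 := norm_nominalForce_le hR hB ht j
  have h4 := norm_sub_norm_le (nominalForce P R j t) (muDes sigma P R K j t s)
  have h5 := norm_sub_norm_le (muDes sigma P R K j t s) (nominalForce P R j t)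
  rw [norm_sub_rev] at h4
  constructor
  · linarith
  · nlinarith

end Bounds

/-! ### Derivatives of the state components along a curve. -/

section StateCurves

variable {s : ℝ → State} {s' : State} {I : Set ℝ} {t : ℝ}

theorem _root_.HasDerivWithinAt.state_xr (h : HasDerivWithinAt s s' I t) :
    HasDerivWithinAt (fun t => State.xr (s t)) (State.xr s') I t :=
  ((ContinuousLinearMap.fst ℝ V _).comp
    (ContinuousLinearMap.fst ℝ (V × V × V × V) (Fin 2 → V × V))).hasFDerivAt.comp_hasDerivWithinAt
    t h

theorem _root_.HasDerivWithinAt.state_vr (h : HasDerivWithinAt s s' I t) :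
    HasDerivWithinAt (fun t => State.vr (s t)) (State.vr s') I t :=
  ((ContinuousLinearMap.fst ℝ V _).comp ((ContinuousLinearMap.snd ℝ V _).comp
    (ContinuousLinearMap.fst ℝ (V × V × V × V) (Fin 2 → V × V)))).hasFDerivAt.comp_hasDerivWithinAt
    t h

theorem _root_.HasDerivWithinAt.state_qr (h : HasDerivWithinAt s s' I t) :
    HasDerivWithinAt (fun t => State.qr (s t)) (State.qr s') I t :=
  ((ContinuousLinearMap.fst ℝ V _).comp ((ContinuousLinearMap.snd ℝ V _).comp
    ((ContinuousLinearMap.snd ℝ V _).comp (ContinuousLinearMap.fst ℝ (V × V × V × V)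
      (Fin 2 → V × V))))).hasFDerivAt.comp_hasDerivWithinAt t h

theorem _root_.HasDerivWithinAt.state_wr (h : HasDerivWithinAt s s' I t) :
    HasDerivWithinAt (fun t => State.wr (s t)) (State.wr s') I t :=
  ((ContinuousLinearMap.snd ℝ V V).comp ((ContinuousLinearMap.snd ℝ V _).comp
    ((ContinuousLinearMap.snd ℝ V _).comp (ContinuousLinearMap.fst ℝ (V × V × V × V)
      (Fin 2 → V × V))))).hasFDerivAt.comp_hasDerivWithinAt t h

theorem _root_.HasDerivWithinAt.state_q (h : HasDerivWithinAt s s' I t) (j : Fin 2) :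
    HasDerivWithinAt (fun t => State.q (s t) j) (State.q s' j) I t :=
  ((ContinuousLinearMap.fst ℝ V V).comp ((ContinuousLinearMap.proj j).comp
    (ContinuousLinearMap.snd ℝ (V × V × V × V)
      (Fin 2 → V × V)))).hasFDerivAt.comp_hasDerivWithinAt t h

theorem _root_.HasDerivWithinAt.state_w (h : HasDerivWithinAt s s' I t) (j : Fin 2) :
    HasDerivWithinAt (fun t => State.w (s t) j) (State.w s' j) I t :=
  ((ContinuousLinearMap.snd ℝ V V).comp ((ContinuousLinearMap.proj j).comp
    (ContinuousLinearMap.snd ℝ (V × V × V × V)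
      (Fin 2 → V × V)))).hasFDerivAt.comp_hasDerivWithinAt t h

end StateCurves

/-! ### A uniform bound on the desired cable angular velocities. -/

section DesiredAngularVelocity

variable {sigma : ℝ} {P : Params} {R : Reference} {B : ℝ}

/-- The derivative of the desired force along the motion is bounded near the reference. -/
theorem exists_muDes_boundedDeriv (K : Gains) (hR : R.Admissible P) (hB : R.BoundedBy B)
    {r M : ℝ} (hr : r ≤ 1)
    (hM : ∀ t s, 0 ≤ t → NearReference R r t s → ∀ j, ‖muDes sigma P R K j t s‖ ≤ M) :
    ∃ b d, ∀ t s, 0 ≤ t → NearReference R r t s → ∀ j,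
      BoundedDeriv (fun h => muDes sigma P R K j h
        (s + (h - t) • reducedField P (mu sigma P R K t s) 0 s)) t b d := by
  -- The bounds are left open and read off from the product rules; only uniformity in `t`, `s` and
  -- `j` matters.
  refine ⟨?b, ?d, fun t s ht hs j => ?bound⟩
  case bound =>
    set F := reducedField P (mu sigma P R K t s) 0 s with hF
    set γ : ℝ → State := fun h => s + (h - t) • F with hγ
    have hγt : γ t = s := by simp [hγ]
    have hd : HasDerivWithinAt γ F Set.univ t := by
      have := (((hasDerivAt_id t).sub_const t).smul_const F).const_add s
      rw [one_smul] at this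
      exact this.hasDerivWithinAt
    have hs1 := hs.phase
    have hmu : ∀ i, ‖mu sigma P R K t s i‖ ≤ 2 * M := fun i => by
      have h1 := hM t s ht hs i
      have h2 : ‖forceErr sigma P R K t s i‖ ≤ M := by
        refine (norm_hat_le _ _).trans ?_
        rw [hs1.unit_q, one_mul]
        refine (norm_hat_le _ _).trans ?_
        rwa [hs1.unit_q, one_mul]
      rw [mu_eq_muDes_add]
      exact (norm_add_le_of_le h1 h2).trans (by linarith)
    have hwr := hs.norm_wr_le hB hr ht
    have hev : BoundedDeriv (fun h => ev R h (γ h)) t 1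
        (1 / P.mr * (2 * M + 2 * M) + ‖P.g • e3‖ + B) := by
      obtain ⟨-, -, ha, -⟩ := hB.a t ht
      have h1 : HasDerivAt R.v (R.a t) t := (hR.contDiff_v.differentiable (by simp) t).hasDerivAt
      refine ⟨_, (hd.state_vr.hasDerivAt Filter.univ_mem).sub h1, ?_, ?_⟩
      · simp only [hγt]
        exact hs.ev_le.trans hr
      · refine norm_sub_le_of_le ?_ ha
        change ‖rodAcc P (mu sigma P R K t s)‖ ≤ _
        refine norm_sub_le_of_le ?_ le_rfl
        have hm := P.mr_pos
        rw [norm_smul, Real.norm_of_nonneg (by positivity)]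
        gcongr
        exact norm_add_le_of_le (hmu 0) (hmu 1)
    have hex : BoundedDeriv (fun h => ex R h (γ h)) t 1 1 := by
      have h1 : HasDerivAt R.x (R.v t) t := (hR.smooth_x.differentiable (by simp) t).hasDerivAt
      refine ⟨_, (hd.state_xr.hasDerivAt Filter.univ_mem).sub h1, ?_, hs.ev_le.trans hr⟩
      simp only [hγt]
      exact hs.ex_le.trans hr
    have hqr : BoundedDeriv (fun h => State.qr (γ h)) t 1 (B + 1) := by
      refine ⟨_, hd.state_qr.hasDerivAt Filter.univ_mem, ?_, ?_⟩
      · simp only [hγt]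
        exact hs1.unit_qr.le
      · change ‖hat (State.wr s) (State.qr s)‖ ≤ _
        refine (norm_hat_le _ _).trans ?_
        rwa [hs1.unit_qr, mul_one]
    have hwr' : BoundedDeriv (fun h => State.wr (γ h)) t (B + 1)
        (1 / P.Ir * (2 * M + 2 * M)) := by
      refine ⟨_, hd.state_wr.hasDerivAt Filter.univ_mem, ?_, ?_⟩
      · simpa only [hγt] using hwr
      · change ‖(1 / P.Ir) • hat (State.qr s) (mu sigma P R K t s 1 - mu sigma P R K t s 0)‖ ≤ _
        have hI := P.Ir_pos
        rw [norm_smul, Real.norm_of_nonneg (by positivity)]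
        gcongr
        refine (norm_hat_le _ _).trans ?_
        rw [hs1.unit_qr, one_mul]
        exact norm_sub_le_of_le (hmu 1) (hmu 0)
    have hsgn : |sgn j| = 1 := by simp [sgn, abs_pow]
    have hRw := hB.w t ht
    have heqr : BoundedDeriv (fun h => eqr R h (γ h)) t _ _ := (hB.q t ht).hat hqr
    have hewr : BoundedDeriv (fun h => ewr R h (γ h)) t _ _ := hwr'.add (hqr.hat (hqr.hat hRw))
    have hqw := hqr.inner hRw
    have hsum : BoundedDeriv (fun h => muSum P R K h (γ h)) t _ _ :=
      ((((hB.a t ht).add (BoundedDeriv.const (P.g • e3))).sub (hev.const_smul K.kv)).sub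
        (hex.const_smul K.kx)).const_smul P.mr
    have hdiff : BoundedDeriv (fun h => muDiff sigma P R K h (γ h)) t _ _ :=
      (((((hqr.hat (hB.wdot t ht)).neg).add
        (((hqw.smul (hqr.hat (hqr.hat hRw))).sub (hqw.smul hewr)).const_smul sigma)).add
        ((hqr.hat hewr).const_smul K.kwr)).add ((hqr.hat heqr).const_smul K.kqr)).const_smul P.Ir
    have hfin := (hsum.add (hdiff.const_smul (sgn j))).const_smul (1 / 2 : ℝ)
    -- This removes the last dependence of the bounds on `j`.
    rw [hsgn] at hfin
    exact hfin

/-- Differentiating `μ̃ = -‖μ̃‖ q̃` and crossing with `q̃` kills the radial part, leaving `q̃ × μ̃'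
= -‖μ̃‖ ω̃`. Hence `‖ω̃‖ ≤ ‖μ̃'‖ / ‖μ̃‖`. -/
theorem exists_norm_wDes_le (K : Gains) (hR : R.Admissible P) (hB : R.BoundedBy B)
    {r c M : ℝ} (hr : r ≤ 1) (hc : 0 < c)
    (hM : ∀ t s, 0 ≤ t → NearReference R r t s → ∀ j,
      c ≤ ‖muDes sigma P R K j t s‖ ∧ ‖muDes sigma P R K j t s‖ ≤ M) :
    ∃ B₁, ∀ t s, 0 ≤ t → NearReference R r t s → ∀ j, ‖wDes sigma P R K j t s‖ ≤ B₁ := by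
  obtain ⟨b, d, hbd⟩ := exists_muDes_boundedDeriv (sigma := sigma) K hR hB hr
    (fun t s ht hs j => (hM t s ht hs j).2)
  refine ⟨d / c, fun t s ht hs j => ?_⟩
  obtain ⟨m', hm, -, hd⟩ := hbd t s ht hs j
  have hcm := (hM t s ht hs j).1
  have h0 : muDes sigma P R K j t s ≠ 0 := norm_pos_iff.1 (hc.trans_le hcm)
  set F := reducedField P (mu sigma P R K t s) 0 s with hF
  have hγt : s + (t - t) • F = s := by simp
  -- A straight line with velocity `F` replaces a solution: `timeDeriv` is a directional derivative
  -- and sees only the velocity at `t`.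
  have hγ : HasDerivAt (fun h => (h, s + (h - t) • F)) (1, F) t := by
    have h2 := (((hasDerivAt_id t).sub_const t).smul_const F).const_add s
    simpa using (hasDerivAt_id t).prodMk h2
  have hq : HasDerivAt (fun h => qDes sigma P R K j h (s + (h - t) • F))
      (timeDeriv sigma P R K (qDes sigma P R K j) t s) t := by
    have h1 : DifferentiableAt ℝ (fun p : ℝ × State => qDes sigma P R K j p.1 p.2)
        (t, s + (t - t) • F) := by
      rw [hγt]
      exact (contDiffAt_qDes (p := (t, s)) hR h0).differentiableAt (by simp)
    have h2 := h1.hasFDerivAt.comp_hasDerivAt t hγ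
    rw [hγt] at h2
    exact h2
  have hN : DifferentiableAt ℝ (fun h => ‖muDes sigma P R K j h (s + (h - t) • F)‖) t :=
    hm.differentiableAt.norm ℝ (by simpa [hγt] using h0)
  have hprod := (hN.hasDerivAt.smul hq).neg
  have heq : (fun h => muDes sigma P R K j h (s + (h - t) • F)) =
      -((fun h => ‖muDes sigma P R K j h (s + (h - t) • F)‖) •
        fun h => qDes sigma P R K j h (s + (h - t) • F)) := funext fun h => muDes_eq
  rw [heq] at hm
  have hm' := hm.unique hprod
  rw [hγt] at hm'
  have hkey : hat (qDes sigma P R K j t s) m' =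
      -(‖muDes sigma P R K j t s‖ • wDes sigma P R K j t s) := by
    rw [hm', hat_neg_right, hat_add_right, hat_smul_right, hat_smul_right, hat_self, smul_zero,
      add_zero, wDes]
  have h3 := norm_hat_le (qDes sigma P R K j t s) m'
  rw [hkey, norm_neg, norm_smul, norm_norm, norm_qDes h0, one_mul] at h3
  rw [le_div_iff₀ hc]
  calc ‖wDes sigma P R K j t s‖ * c
      ≤ ‖wDes sigma P R K j t s‖ * ‖muDes sigma P R K j t s‖ := by gcongr
    _ ≤ d := by linarith

end DesiredAngularVelocity

/-! ### The Lyapunov function of the closed loop -/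

/-- The gains, for a reference bounded by `B` and desired cable angular velocities bounded
by `B₁`. -/
noncomputable def gains (B B₁ : ℝ) : Gains :=
  ⟨3, 2, stiffness B (2 * B * (B + 1)), 2, fun _ => stiffness B₁ 0, fun _ => 2⟩

theorem gains_kq (B B₁ : ℝ) (j : Fin 2) : (gains B B₁).kq j = stiffness B₁ 0 := rfl

theorem gains_kw (B B₁ : ℝ) (j : Fin 2) : (gains B B₁).kw j = 2 := rfl

theorem gains_kqr (B B₁ : ℝ) : (gains B B₁).kqr = stiffness B (2 * B * (B + 1)) := rfl

theorem gains_kwr (B B₁ : ℝ) : (gains B B₁).kwr = 2 := rfl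

/-- Bounds valid within distance `r` of the reference. -/
structure LocalBounds (sigma : ℝ) (P : Params) (R : Reference) (B r c M B₁ : ℝ) : Prop where
  ref : R.BoundedBy B
  r_pos : 0 < r
  r_le_one : r ≤ 1
  c_pos : 0 < c
  M_pos : 0 < M
  le_muDes : ∀ t s, 0 ≤ t → NearReference R r t s → ∀ j, c ≤ ‖muDes sigma P R (gains B B₁) j t s‖
  muDes_le : ∀ t s, 0 ≤ t → NearReference R r t s → ∀ j, ‖muDes sigma P R (gains B B₁) j t s‖ ≤ M
  wDes_le : ∀ t s, 0 ≤ t → NearReference R r t s → ∀ j, ‖wDes sigma P R (gains B B₁) j t s‖ ≤ B₁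

/-- `B₁` is needed for the cable gains but is a bound on a controlled quantity. There is no
circularity, since `muDes` and `wDes` involve only the rod gains: bounds found for `gains B 0` hold
by definition for `gains B B₁`. -/
theorem exists_localBounds {sigma : ℝ} {P : Params} {R : Reference} (hR : R.Admissible P)
    (hsigma : |sigma| = 1) : ∃ B r c M B₁, LocalBounds sigma P R B r c M B₁ := by
  obtain ⟨B, hB⟩ := hR.exists_boundedBy
  obtain ⟨r, c, M, hr, hr1, hc, hM, hmu⟩ :=
    exists_norm_muDes_bounds (gains B 0) hR hB hsigma
  obtain ⟨B₁, hw⟩ := exists_norm_wDes_le (gains B 0) hR hB hr1 hc hmu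
  exact ⟨B, r, c, M, B₁, hB, hr, hr1, hc, hM, fun t s ht hs j => (hmu t s ht hs j).1,
    fun t s ht hs j => (hmu t s ht hs j).2, fun t s ht hs j => hw t s ht hs j⟩

/-- The Lyapunov function of the position error. -/
noncomputable def posLyap (x v : V) : ℝ :=
  1 / 2 * ‖v‖ ^ 2 + 3 / 2 * ‖x‖ ^ 2 + inner ℝ x v

theorem le_posLyap (x v : V) : 1 / 4 * ‖v‖ ^ 2 + 1 / 4 * ‖x‖ ^ 2 ≤ posLyap x v := by
  have h1 := (abs_le.1 (abs_real_inner_le_norm x v)).1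
  rw [posLyap]
  nlinarith [sq_nonneg (‖x‖ - 1 / 2 * ‖v‖), sq_nonneg ‖x‖]

theorem posLyap_le (x v : V) : posLyap x v ≤ 2 * ‖v‖ ^ 2 + 2 * ‖x‖ ^ 2 := by
  have h1 := real_inner_le_norm x v
  rw [posLyap]
  nlinarith [sq_nonneg (‖x‖ - ‖v‖), sq_nonneg ‖x‖, sq_nonneg ‖v‖]

/-- With gains `3` and `2` the unperturbed derivative is `-‖v‖² - 3 ‖x‖² - 2 x · v`, and the last
term is at most `‖v‖² / 2 + 2 ‖x‖²`. -/
theorem hasDerivWithinAt_posLyap {x v : ℝ → V} {I : Set ℝ} {t d : ℝ} {D : V}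
    (hx : HasDerivWithinAt x (v t) I t)
    (hv : HasDerivWithinAt v (-((2 : ℝ) • v t) - (3 : ℝ) • x t + D) I t) (hD : ‖D‖ ≤ d) :
    ∃ v', HasDerivWithinAt (fun t => posLyap (x t) (v t)) v' I t ∧
      v' ≤ -(1 / 2) * ‖v t‖ ^ 2 - ‖x t‖ ^ 2 + (‖x t‖ + ‖v t‖) * d := by
  refine ⟨_, ((hv.norm_sq.const_mul (1 / 2)).add (hx.norm_sq.const_mul (3 / 2))).add
    (hx.inner ℝ hv), ?_⟩
  simp only [inner_add_right, inner_sub_right, inner_smul_right, inner_neg_right,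
    real_inner_self_eq_norm_sq, real_inner_comm (x t) (v t)]
  have h1 := (abs_le.1 (abs_real_inner_le_norm (x t) (v t))).1
  have h2 : inner ℝ (v t) D ≤ ‖v t‖ * d := (real_inner_le_norm _ _).trans (by gcongr)
  have h3 : inner ℝ (x t) D ≤ ‖x t‖ * d := (real_inner_le_norm _ _).trans (by gcongr)
  nlinarith [sq_nonneg (‖v t‖ - 2 * ‖x t‖)]

section Lyapunov

variable (sigma : ℝ) (P : Params) (R : Reference) (B M B₁ : ℝ)

/-- The weight of the cables in the Lyapunov function. -/
noncomputable def cableWeight (P : Params) (M : ℝ) : ℝ := 16 * (M / P.mr + M / P.Ir) ^ 2 + 1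

theorem one_le_cableWeight (P : Params) (M : ℝ) : 1 ≤ cableWeight P M := by
  unfold cableWeight; nlinarith [sq_nonneg (M / P.mr + M / P.Ir)]

/-- The Lyapunov function of the attitude of cable `j`. -/
noncomputable def cableLyap (j : Fin 2) (t : ℝ) (s : State) : ℝ :=
  attLyap (stiffness B₁ 0) (qDes sigma P R (gains B B₁) j t s)
    (wDes sigma P R (gains B B₁) j t s) (State.q s j) (State.w s j)

/-- The Lyapunov function of the closed loop. -/
noncomputable def lyap (t : ℝ) (s : State) : ℝ :=
  posLyap (ex R t s) (ev R t s)
    + attLyap (stiffness B (2 * B * (B + 1))) (R.q t) (R.w t) (State.qr s) (State.wr s)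
    + cableWeight P M * (cableLyap sigma P R B B₁ 0 t s + cableLyap sigma P R B B₁ 1 t s)

variable {sigma P R B M B₁}

theorem errNorm_sq (K : Gains) (t : ℝ) (s : State) :
    errNorm sigma P R K t s ^ 2 = ‖ex R t s‖ ^ 2 + ‖ev R t s‖ ^ 2 + ‖eqr R t s‖ ^ 2
      + ‖ewr R t s‖ ^ 2 + (‖eqj sigma P R K 0 t s‖ ^ 2 + ‖ewj sigma P R K 0 t s‖ ^ 2)
      + (‖eqj sigma P R K 1 t s‖ ^ 2 + ‖ewj sigma P R K 1 t s‖ ^ 2) := by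
  rw [errNorm, Real.sq_sqrt (by positivity), Fin.sum_univ_two]
  ring

/-- This has the shape of the hypothesis on `D` in `hasDerivWithinAt_attLyap`: the drift is the part
`b ‖attErr‖` with the `b` used in the rod stiffness, and the force errors form the part `d`. -/
theorem norm_rodDist_le {r c : ℝ} (hL : LocalBounds sigma P R B r c M B₁) (hR : R.Admissible P)
    (hsigma : |sigma| = 1) {t : ℝ} {s : State} (ht : 0 ≤ t) (hs : NearReference R r t s) :
    ‖rodDist sigma P R (gains B B₁) t s‖ ≤ 2 * B * (B + 1) * ‖attErr (R.q t) (State.qr s)‖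
      + M / P.Ir * (‖eqj sigma P R (gains B B₁) 0 t s‖ + ‖eqj sigma P R (gains B B₁) 1 t s‖) := by
  have hI := P.Ir_pos
  have hB0 := hL.ref.nonneg
  have hqr := hs.phase.unit_qr
  obtain ⟨-, -, hw, -⟩ := hL.ref.w t ht
  have hwr := hs.norm_wr_le hL.ref hL.r_le_one ht
  have hf : ∀ j, ‖forceErr sigma P R (gains B B₁) t s j‖ ≤
      M * ‖eqj sigma P R (gains B B₁) j t s‖ := fun j =>
    (norm_forceErr_le (hs.phase.unit_q j)).trans (by gcongr; exact hL.muDes_le t s ht hs j)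
  rw [rodDist]
  refine norm_add_le_of_le ?_ ?_
  · have h1 : |1 + sigma| ≤ 2 := (abs_add_le _ _).trans (by rw [hsigma, abs_one]; norm_num)
    have h2 : |inner ℝ (State.qr s) (R.w t)| ≤ B * ‖attErr (R.q t) (State.qr s)‖ :=
      (abs_inner_le_of_orthogonal (hR.unit_q t) _ (R.inner_q_w t)).trans (by gcongr)
    have h3 : ‖hat (State.qr s) (State.wr s)‖ ≤ B + 1 :=
      (norm_hat_le _ _).trans (by rwa [hqr, one_mul])
    rw [norm_neg, norm_smul, norm_smul, Real.norm_eq_abs, Real.norm_eq_abs]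
    calc |1 + sigma| * (|inner ℝ (State.qr s) (R.w t)| * ‖hat (State.qr s) (State.wr s)‖)
        ≤ 2 * ((B * ‖attErr (R.q t) (State.qr s)‖) * (B + 1)) := by gcongr
      _ = _ := by ring
  · rw [norm_smul, Real.norm_of_nonneg (by positivity)]
    have h1 := norm_hat_le (State.qr s) (forceErr sigma P R (gains B B₁) t s 1
      - forceErr sigma P R (gains B B₁) t s 0)
    rw [hqr, one_mul] at h1
    have h2 := norm_sub_le_of_le (hf 1) (hf 0)
    calc 1 / P.Ir * ‖_‖ ≤ 1 / P.Ir * (M * ‖eqj sigma P R (gains B B₁) 1 t s‖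
          + M * ‖eqj sigma P R (gains B B₁) 0 t s‖) := by gcongr; exact h1.trans h2
      _ = _ := by ring

theorem hasDerivWithinAt_cableLyap {r c : ℝ} (hL : LocalBounds sigma P R B r c M B₁)
    (hR : R.Admissible P) {t : ℝ} {s : ℝ → State} {I : Set ℝ} (ht : 0 ≤ t)
    (hs : NearReference R r t (s t))
    (hd : HasDerivWithinAt s (closedLoop sigma P R (gains B B₁) t (s t)) I t) (j : Fin 2) :
    ∃ v', HasDerivWithinAt (fun t => cableLyap sigma P R B B₁ j t (s t)) v' I t ∧
      v' ≤ -(1 / 2) * ‖ewj sigma P R (gains B B₁) j t (s t)‖ ^ 2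
        - 3 * ‖eqj sigma P R (gains B B₁) j t (s t)‖ ^ 2 := by
  have h0 : muDes sigma P R (gains B B₁) j t (s t) ≠ 0 :=
    norm_pos_iff.1 (hL.c_pos.trans_le (hL.le_muDes t _ ht hs j))
  have hp : HasDerivWithinAt (fun t => qDes sigma P R (gains B B₁) j t (s t))
      (hat (wDes sigma P R (gains B B₁) j t (s t)) (qDes sigma P R (gains B B₁) j t (s t))) I t := by
    rw [hat_wDes_qDes hR h0]
    exact hasDerivWithinAt_timeDeriv
      ((contDiffAt_qDes (p := (t, s t)) hR h0).differentiableAt (by simp))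
      (fun _ _ _ h _ => qDes_congr h) hd
  have hz : HasDerivWithinAt (fun t => wDes sigma P R (gains B B₁) j t (s t))
      (wDesDot sigma P R (gains B B₁) j t (s t)) I t :=
    hasDerivWithinAt_timeDeriv
      ((contDiffAt_wDes (p := (t, s t)) hR h0).differentiableAt (by simp))
      (fun _ _ _ h h' => wDes_congr h h') hd
  have hfb := closedLoop_cable (sigma := sigma) (P := P) (R := R) (K := gains B B₁) (t := t)
    hs.phase j
  -- The added zero is the disturbance `D = 0` of the cable equation.
  rw [gains_kq, gains_kw, ← add_zero (_ - _ - _)] at hfb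
  have hB := hL.wDes_le t _ ht hs j
  have hu := norm_qDes h0
  have ho := inner_qDes_wDes (sigma := sigma) (P := P) (R := R) (K := gains B B₁) (j := j) (t := t)
    (s := s t)
  unfold cableLyap eqj ewj
  generalize gains B B₁ = K at *
  obtain ⟨v', h1, h2⟩ := hasDerivWithinAt_attLyap (B := B₁) (b := 0) (d := 0) (D := 0)
    (q := fun t => State.q (s t) j) (w := fun t => State.w (s t) j)
    (p := fun t => qDes sigma P R K j t (s t)) (z := fun t => wDes sigma P R K j t (s t))
    (hs.phase.unit_q j) hu (hs.phase.orth_w j) ho (hd.state_q j)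
    (hd.state_w j) hp hz hfb hB (by simp)
  exact ⟨v', h1, h2.trans (le_of_eq (by rw [mul_zero, add_zero]))⟩

theorem hasDerivWithinAt_posLyap_closedLoop {r c : ℝ} (hL : LocalBounds sigma P R B r c M B₁)
    (hR : R.Admissible P) {t : ℝ} {s : ℝ → State} {I : Set ℝ} (ht : 0 ≤ t)
    (hs : NearReference R r t (s t))
    (hd : HasDerivWithinAt s (closedLoop sigma P R (gains B B₁) t (s t)) I t) :
    ∃ v', HasDerivWithinAt (fun t => posLyap (ex R t (s t)) (ev R t (s t))) v' I t ∧
      v' ≤ -(1 / 2) * ‖ev R t (s t)‖ ^ 2 - ‖ex R t (s t)‖ ^ 2 + (‖ex R t (s t)‖ + ‖ev R t (s t)‖) *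
        (M / P.mr * (‖eqj sigma P R (gains B B₁) 0 t (s t)‖
          + ‖eqj sigma P R (gains B B₁) 1 t (s t)‖)) := by
  have hm := P.mr_pos
  have hf : ∀ j, ‖forceErr sigma P R (gains B B₁) t (s t) j‖ ≤
      M * ‖eqj sigma P R (gains B B₁) j t (s t)‖ := fun j =>
    (norm_forceErr_le (hs.phase.unit_q j)).trans (by gcongr; exact hL.muDes_le t _ ht hs j)
  have hx : HasDerivWithinAt (fun t => ex R t (s t)) (ev R t (s t)) I t :=
    hd.state_xr.sub (hR.smooth_x.differentiable (by simp) t).hasDerivAt.hasDerivWithinAt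
  have hv : HasDerivWithinAt (fun t => ev R t (s t))
      (-((2 : ℝ) • ev R t (s t)) - (3 : ℝ) • ex R t (s t) + (1 / P.mr) •
        (forceErr sigma P R (gains B B₁) t (s t) 0
          + forceErr sigma P R (gains B B₁) t (s t) 1)) I t := by
    refine (hd.state_vr.sub
      (hR.contDiff_v.differentiable (by simp) t).hasDerivAt.hasDerivWithinAt).congr_deriv ?_
    change rodAcc P (mu sigma P R (gains B B₁) t (s t)) - R.a t = _
    rw [rodAcc_mu]
    simp only [gains]
    module
  refine hasDerivWithinAt_posLyap hx hv ?_
  rw [norm_smul, Real.norm_of_nonneg (by positivity)]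
  calc 1 / P.mr * ‖_‖ ≤ 1 / P.mr * (M * ‖eqj sigma P R (gains B B₁) 0 t (s t)‖
        + M * ‖eqj sigma P R (gains B B₁) 1 t (s t)‖) := by
          gcongr; exact norm_add_le_of_le (hf 0) (hf 1)
    _ = _ := by ring

theorem hasDerivWithinAt_rodLyap {r c : ℝ} (hL : LocalBounds sigma P R B r c M B₁)
    (hR : R.Admissible P) (hsigma : |sigma| = 1) {t : ℝ} {s : ℝ → State} {I : Set ℝ} (ht : 0 ≤ t)
    (hs : NearReference R r t (s t))
    (hd : HasDerivWithinAt s (closedLoop sigma P R (gains B B₁) t (s t)) I t) :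
    ∃ v', HasDerivWithinAt (fun t => attLyap (stiffness B (2 * B * (B + 1))) (R.q t) (R.w t)
        (State.qr (s t)) (State.wr (s t))) v' I t ∧
      v' ≤ -(1 / 2) * ‖ewr R t (s t)‖ ^ 2 - 3 * ‖eqr R t (s t)‖ ^ 2
        + (‖eqr R t (s t)‖ + ‖ewr R t (s t)‖) *
        (M / P.Ir * (‖eqj sigma P R (gains B B₁) 0 t (s t)‖
          + ‖eqj sigma P R (gains B B₁) 1 t (s t)‖)) := by
  obtain ⟨-, -, hRwB, -⟩ := hL.ref.w t ht
  have hRw : HasDerivAt R.w (R.wdot t) t :=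
    (hR.contDiff_w.differentiable (by simp) t).hasDerivAt
  have hfb := rodAngAcc_mu (sigma := sigma) (P := P) (R := R) (K := gains B B₁) (t := t) hs.phase
  have hw : HasDerivWithinAt (fun t => State.wr (s t))
    (rodAngAcc P (mu sigma P R (gains B B₁) t (s t)) (s t)) I t := hd.state_wr
  have hq : HasDerivWithinAt (fun t => State.qr (s t))
    (hat (State.wr (s t)) (State.qr (s t))) I t := hd.state_qr
  rw [gains_kqr, gains_kwr] at hfb
  unfold ewr eqr
  exact hasDerivWithinAt_attLyap (B := B) (q := fun t => State.qr (s t))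
    (w := fun t => State.wr (s t)) (p := R.q) (z := R.w) hs.phase.unit_qr (hR.unit_q t)
    hs.phase.orth_wr (R.inner_q_w t) hq hw (hR.hasDerivAt_q t).hasDerivWithinAt
    hRw.hasDerivWithinAt hfb hRwB (norm_rodDist_le hL hR hsigma ht hs)

/-- The decay rates of the parts of the Lyapunov function dominate the interconnection. -/
theorem lyap_rate_le {x y xr yr x0 y0 x1 y1 κ₁ κ₂ vx vr v0 v1 : ℝ} (hx : 0 ≤ x) (hy : 0 ≤ y)
    (hxr : 0 ≤ xr) (hyr : 0 ≤ yr) (hx0 : 0 ≤ x0) (hx1 : 0 ≤ x1) (hκ₁ : 0 ≤ κ₁) (hκ₂ : 0 ≤ κ₂)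
    (hvx : vx ≤ -(1 / 2) * y ^ 2 - x ^ 2 + (x + y) * (κ₁ * (x0 + x1)))
    (hvr : vr ≤ -(1 / 2) * yr ^ 2 - 3 * xr ^ 2 + (xr + yr) * (κ₂ * (x0 + x1)))
    (hv0 : v0 ≤ -(1 / 2) * y0 ^ 2 - 3 * x0 ^ 2) (hv1 : v1 ≤ -(1 / 2) * y1 ^ 2 - 3 * x1 ^ 2) :
    vx + vr + (16 * (κ₁ + κ₂) ^ 2 + 1) * (v0 + v1) ≤
      -(1 / 4) * (x ^ 2 + y ^ 2 + xr ^ 2 + yr ^ 2 + (x0 ^ 2 + y0 ^ 2) + (x1 ^ 2 + y1 ^ 2)) := by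
  have hS : 0 ≤ x0 + x1 := by positivity
  have hk1 : κ₁ * (x0 + x1) ≤ (κ₁ + κ₂) * (x0 + x1) := by gcongr; linarith
  have hk2 : κ₂ * (x0 + x1) ≤ (κ₁ + κ₂) * (x0 + x1) := by gcongr; linarith
  set κ := κ₁ + κ₂
  have e1 := mul_le_mul_of_nonneg_left hk1 (show 0 ≤ x + y by positivity)
  have e2 := mul_le_mul_of_nonneg_left hk2 (show 0 ≤ xr + yr by positivity)
  -- Four such terms cost `8 κ² (x0² + x1²)` in total, while the weighted cable rates supply `3 (16
  -- κ² + 1)` times the same sum.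
  have young : ∀ a : ℝ, a * (κ * (x0 + x1)) ≤ 1 / 4 * a ^ 2 + 2 * κ ^ 2 * (x0 ^ 2 + x1 ^ 2) := by
    intro a
    have h1 := sq_nonneg (1 / 2 * a - κ * (x0 + x1))
    have h2 := mul_nonneg (sq_nonneg κ) (sq_nonneg (x0 - x1))
    linarith
  have f1 := young x
  have f2 := young y
  have f3 := young xr
  have f4 := young yr
  have g := mul_le_mul_of_nonneg_left (add_le_add hv0 hv1)
    (show 0 ≤ 16 * κ ^ 2 + 1 by positivity)
  have hy : 0 ≤ κ ^ 2 * (y0 ^ 2 + y1 ^ 2) := by positivity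
  have hx0 : 0 ≤ κ ^ 2 * (x0 ^ 2 + x1 ^ 2) := by positivity
  linarith [sq_nonneg x, sq_nonneg y, sq_nonneg xr, sq_nonneg yr, sq_nonneg x0, sq_nonneg x1,
    sq_nonneg y0, sq_nonneg y1]

/-- The Lyapunov function decays along the closed loop near the reference. -/
theorem hasDerivWithinAt_lyap {r c : ℝ} (hL : LocalBounds sigma P R B r c M B₁)
    (hR : R.Admissible P) (hsigma : |sigma| = 1) {t : ℝ} {s : ℝ → State} {I : Set ℝ} (ht : 0 ≤ t)
    (hs : NearReference R r t (s t))
    (hd : HasDerivWithinAt s (closedLoop sigma P R (gains B B₁) t (s t)) I t) :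
    ∃ v', HasDerivWithinAt (fun t => lyap sigma P R B M B₁ t (s t)) v' I t ∧
      v' ≤ -(1 / 4) * errNorm sigma P R (gains B B₁) t (s t) ^ 2 := by
  have hm := P.mr_pos
  have hI := P.Ir_pos
  have hM := hL.M_pos
  obtain ⟨vx, hvx, hvx'⟩ := hasDerivWithinAt_posLyap_closedLoop hL hR ht hs hd
  obtain ⟨vr, hvr, hvr'⟩ := hasDerivWithinAt_rodLyap hL hR hsigma ht hs hd
  obtain ⟨v0, hv0, hv0'⟩ := hasDerivWithinAt_cableLyap hL hR ht hs hd 0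
  obtain ⟨v1, hv1, hv1'⟩ := hasDerivWithinAt_cableLyap hL hR ht hs hd 1
  refine ⟨_, (hvx.add hvr).add ((hv0.add hv1).const_mul (cableWeight P M)), ?_⟩
  rw [errNorm_sq]
  exact lyap_rate_le (norm_nonneg _) (norm_nonneg _) (norm_nonneg _) (norm_nonneg _)
    (norm_nonneg _) (norm_nonneg _) (by positivity) (by positivity) hvx' hvr' hv0' hv1'

/-- The cable attitude errors are at most `1 / 2`. -/
def CablesAligned (sigma : ℝ) (P : Params) (R : Reference) (K : Gains) (t : ℝ) (s : State) : Prop :=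
  ∀ j, Psi (qDes sigma P R K j t s) (State.q s j) ≤ 1 / 2

theorem le_lyap {r c : ℝ} (hL : LocalBounds sigma P R B r c M B₁) (hR : R.Admissible P)
    {t : ℝ} {s : State} (ht : 0 ≤ t) (hs : NearReference R r t s) :
    1 / 4 * ‖ev R t s‖ ^ 2 + 1 / 4 * ‖ex R t s‖ ^ 2
      + (1 / 4 * ‖ewr R t s‖ ^ 2 + Psi (R.q t) (State.qr s))
      + ((1 / 4 * ‖ewj sigma P R (gains B B₁) 0 t s‖ ^ 2
          + Psi (qDes sigma P R (gains B B₁) 0 t s) (State.q s 0))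
        + (1 / 4 * ‖ewj sigma P R (gains B B₁) 1 t s‖ ^ 2
          + Psi (qDes sigma P R (gains B B₁) 1 t s) (State.q s 1))) ≤
      lyap sigma P R B M B₁ t s := by
  have h0 : ∀ j, muDes sigma P R (gains B B₁) j t s ≠ 0 := fun j =>
    norm_pos_iff.1 (hL.c_pos.trans_le (hL.le_muDes t _ ht hs j))
  have hB := hL.ref.nonneg
  have hN := one_le_cableWeight P M
  have hc : ∀ j, 0 ≤ 1 / 4 * ‖ewj sigma P R (gains B B₁) j t s‖ ^ 2
      + Psi (qDes sigma P R (gains B B₁) j t s) (State.q s j) ∧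
      1 / 4 * ‖ewj sigma P R (gains B B₁) j t s‖ ^ 2
      + Psi (qDes sigma P R (gains B B₁) j t s) (State.q s j) ≤ cableLyap sigma P R B B₁ j t s := by
    intro j
    have h1 := Psi_nonneg (norm_qDes (h0 j)) (hs.phase.unit_q j)
    exact ⟨by positivity, le_attLyap (three_le_stiffness le_rfl) (norm_qDes (h0 j))
      (hs.phase.unit_q j) _ _⟩
  have h1 := le_posLyap (ex R t s) (ev R t s)
  have h2 := le_attLyap (three_le_stiffness (B := B) (show 0 ≤ 2 * B * (B + 1) by positivity))
    (hR.unit_q t) hs.phase.unit_qr (R.w t) (State.wr s)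
  obtain ⟨p0, l0⟩ := hc 0
  obtain ⟨p1, l1⟩ := hc 1
  unfold lyap
  refine add_le_add (add_le_add h1 h2) ((add_le_add l0 l1).trans ?_)
  exact le_mul_of_one_le_left (by linarith) hN

theorem errNorm_sq_le_lyap {r c : ℝ} (hL : LocalBounds sigma P R B r c M B₁) (hR : R.Admissible P)
    {t : ℝ} {s : State} (ht : 0 ≤ t) (hs : NearReference R r t s) :
    errNorm sigma P R (gains B B₁) t s ^ 2 ≤ 4 * lyap sigma P R B M B₁ t s := by
  have h0 : ∀ j, muDes sigma P R (gains B B₁) j t s ≠ 0 := fun j =>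
    norm_pos_iff.1 (hL.c_pos.trans_le (hL.le_muDes t _ ht hs j))
  have h1 := le_lyap hL hR ht hs
  have h2 := norm_attErr_sq_le (hR.unit_q t) hs.phase.unit_qr
  have h3 := fun j => norm_attErr_sq_le (norm_qDes (h0 j)) (hs.phase.unit_q j)
  have h4 := fun j => Psi_nonneg (norm_qDes (h0 j)) (hs.phase.unit_q j)
  have h5 := Psi_nonneg (hR.unit_q t) hs.phase.unit_qr
  have e0 := h3 0
  have e1 := h3 1
  have f0 := h4 0
  have f1 := h4 1
  rw [errNorm_sq]
  unfold eqr eqj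
  linarith

/-- The constant in the upper bound of the Lyapunov function. -/
noncomputable def lyapUpper (P : Params) (B M B₁ : ℝ) : ℝ :=
  stiffness B (2 * B * (B + 1)) + 1 + cableWeight P M * (stiffness B₁ 0 + 1)

theorem lyap_le_explicit (t : ℝ) (s : State) :
    lyap sigma P R B M B₁ t s ≤ 2 * ‖ev R t s‖ ^ 2 + 2 * ‖ex R t s‖ ^ 2
      + (‖ewr R t s‖ ^ 2 + stiffness B (2 * B * (B + 1)) * Psi (R.q t) (State.qr s)
        + ‖eqr R t s‖ ^ 2)
      + cableWeight P M * ((‖ewj sigma P R (gains B B₁) 0 t s‖ ^ 2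
          + stiffness B₁ 0 * Psi (qDes sigma P R (gains B B₁) 0 t s) (State.q s 0)
          + ‖eqj sigma P R (gains B B₁) 0 t s‖ ^ 2)
        + (‖ewj sigma P R (gains B B₁) 1 t s‖ ^ 2
          + stiffness B₁ 0 * Psi (qDes sigma P R (gains B B₁) 1 t s) (State.q s 1)
          + ‖eqj sigma P R (gains B B₁) 1 t s‖ ^ 2)) := by
  have hN : 0 ≤ cableWeight P M := by linarith [one_le_cableWeight P M]
  unfold lyap
  exact add_le_add (add_le_add (posLyap_le _ _) (attLyap_le _ _ _ _))
    (mul_le_mul_of_nonneg_left (add_le_add (attLyap_le _ _ _ _) (attLyap_le _ _ _ _)) hN)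

theorem four_le_lyapUpper {r c : ℝ} (hL : LocalBounds sigma P R B r c M B₁) :
    4 ≤ lyapUpper P B M B₁ := by
  have hB := hL.ref.nonneg
  have hN := one_le_cableWeight P M
  have h1 := three_le_stiffness (B := B) (show 0 ≤ 2 * B * (B + 1) by positivity)
  have h2 := three_le_stiffness (B := B₁) (b := 0) le_rfl
  unfold lyapUpper
  nlinarith

/-- Alignment is essential: near the antipode `attErr` is small while `Ψ` is close to `2`. For `Ψ ≤
1` one has `Ψ ≤ ‖attErr‖²`. -/
theorem lyap_le_errNorm_sq {r c : ℝ} (hL : LocalBounds sigma P R B r c M B₁) (hR : R.Admissible P)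
    {t : ℝ} {s : State} (ht : 0 ≤ t) (hs : NearReference R r t s)
    (ha : CablesAligned sigma P R (gains B B₁) t s) :
    lyap sigma P R B M B₁ t s ≤
      lyapUpper P B M B₁ * errNorm sigma P R (gains B B₁) t s ^ 2 := by
  have h0 : ∀ j, muDes sigma P R (gains B B₁) j t s ≠ 0 := fun j =>
    norm_pos_iff.1 (hL.c_pos.trans_le (hL.le_muDes t _ ht hs j))
  have hB := hL.ref.nonneg
  have hN := one_le_cableWeight P M
  have hk := three_le_stiffness (B := B) (show 0 ≤ 2 * B * (B + 1) by positivity)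
  have hk₁ := three_le_stiffness (B := B₁) (b := 0) le_rfl
  have hr : Psi (R.q t) (State.qr s) ≤ ‖eqr R t s‖ ^ 2 := by
    refine Psi_le_norm_attErr_sq (hR.unit_q t) hs.phase.unit_qr ?_
    have h1 := norm_sub_sq_eq_two_mul_Psi (hR.unit_q t) hs.phase.unit_qr
    have h2 := hs.q_le.trans hL.r_le_one
    nlinarith [norm_nonneg (State.qr s - R.q t)]
  have hj : ∀ j, Psi (qDes sigma P R (gains B B₁) j t s) (State.q s j) ≤
      ‖eqj sigma P R (gains B B₁) j t s‖ ^ 2 := fun j =>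
    Psi_le_norm_attErr_sq (norm_qDes (h0 j)) (hs.phase.unit_q j) ((ha j).trans (by norm_num))
  refine (lyap_le_explicit t s).trans ?_
  rw [errNorm_sq, lyapUpper]
  set k := stiffness B (2 * B * (B + 1))
  set k₁ := stiffness B₁ 0
  set N := cableWeight P M
  have e1 : k * Psi (R.q t) (State.qr s) ≤ k * ‖eqr R t s‖ ^ 2 := by gcongr
  have e2 : ∀ j, ‖ewj sigma P R (gains B B₁) j t s‖ ^ 2
      + k₁ * Psi (qDes sigma P R (gains B B₁) j t s) (State.q s j)
      + ‖eqj sigma P R (gains B B₁) j t s‖ ^ 2 ≤ (k₁ + 1) *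
      (‖eqj sigma P R (gains B B₁) j t s‖ ^ 2 + ‖ewj sigma P R (gains B B₁) j t s‖ ^ 2) := by
    intro j
    have h1 := mul_le_mul_of_nonneg_left (hj j) (show 0 ≤ k₁ by linarith)
    have h2 : 0 ≤ k₁ * ‖ewj sigma P R (gains B B₁) j t s‖ ^ 2 := by positivity
    linarith
  have e3 := mul_le_mul_of_nonneg_left (add_le_add (e2 0) (e2 1)) (show 0 ≤ N by linarith)
  set y := ‖ex R t s‖ ^ 2 + ‖ev R t s‖ ^ 2 + ‖eqr R t s‖ ^ 2 + ‖ewr R t s‖ ^ 2 with hy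
  set z := (‖eqj sigma P R (gains B B₁) 0 t s‖ ^ 2 + ‖ewj sigma P R (gains B B₁) 0 t s‖ ^ 2)
    + (‖eqj sigma P R (gains B B₁) 1 t s‖ ^ 2 + ‖ewj sigma P R (gains B B₁) 1 t s‖ ^ 2) with hz
  have hy0 : 0 ≤ y := by positivity
  have hz0 : 0 ≤ z := by positivity
  have e4 : 2 * ‖ev R t s‖ ^ 2 + 2 * ‖ex R t s‖ ^ 2 + (‖ewr R t s‖ ^ 2
      + k * Psi (R.q t) (State.qr s) + ‖eqr R t s‖ ^ 2) ≤ (k + 1) * y := by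
    rw [hy]
    have a1 : 0 ≤ (k - 1) * (‖ev R t s‖ ^ 2 + ‖ex R t s‖ ^ 2) :=
      mul_nonneg (by linarith) (by positivity)
    have a2 : 0 ≤ k * ‖ewr R t s‖ ^ 2 := by positivity
    linarith
  have e5 : 0 ≤ N * (k₁ + 1) * y := by positivity
  have e6 : 0 ≤ (k + 1) * z := by positivity
  rw [← mul_add, ← hz] at e3
  rw [add_assoc y, ← hz]
  linarith

end Lyapunov

/-! ### Invariance of the phase space. -/

section PhaseSpace

open Set

theorem eq_left_of_hasDerivWithinAt_zero {f : ℝ → ℝ} {a b : ℝ}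
    (h : ∀ t ∈ Ico a b, HasDerivWithinAt f 0 (Ico a b) t) : ∀ t ∈ Ico a b, f t = f a := by
  intro t ht
  have := (convex_Ico a b).norm_image_sub_le_of_norm_hasDerivWithin_le (C := 0) h (by simp)
    (left_mem_Ico.2 (ht.1.trans_lt ht.2)) ht
  rw [zero_mul, norm_le_zero_iff, sub_eq_zero] at this
  exact this

/-- Both `‖q‖²` and `q · w` are conserved: `w × q` is orthogonal to `q` and to `w`, and every
angular acceleration here is a cross product with `q`. -/
theorem unit_orthogonal_of_hasDerivWithinAt {q w : ℝ → V} {w' : ℝ → V} {a b : ℝ}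
    (hq : ∀ t ∈ Ico a b, HasDerivWithinAt q (hat (w t) (q t)) (Ico a b) t)
    (hw : ∀ t ∈ Ico a b, HasDerivWithinAt w (w' t) (Ico a b) t)
    (hw' : ∀ t, inner ℝ (q t) (w' t) = 0) (hu : ‖q a‖ = 1) (ho : inner ℝ (q a) (w a) = 0) :
    ∀ t ∈ Ico a b, ‖q t‖ = 1 ∧ inner ℝ (q t) (w t) = 0 := by
  intro t ht
  constructor
  · have h := eq_left_of_hasDerivWithinAt_zero (f := fun t => ‖q t‖ ^ 2) (fun t ht =>
      ((hq t ht).norm_sq).congr_deriv (by rw [inner_hat_right, mul_zero])) t ht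
    simp only [hu, one_pow] at h
    exact (pow_eq_one_iff_of_nonneg (norm_nonneg _) two_ne_zero).1 h
  · have h := eq_left_of_hasDerivWithinAt_zero (f := fun t => inner ℝ (q t) (w t)) (fun t ht =>
      ((hq t ht).inner ℝ (hw t ht)).congr_deriv (by
        rw [hw', real_inner_comm, inner_hat_left, add_zero])) t ht
    exact h.trans ho

/-- The phase space is invariant under the closed loop. -/
theorem onPhaseSpace_of_isSolutionOn {sigma : ℝ} {P : Params} {R : Reference} {K : Gains}
    {s : ℝ → State} {a b : ℝ} (hs : IsSolutionOn sigma P R K s (Ico a b))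
    (h0 : OnPhaseSpace (s a)) : ∀ t ∈ Ico a b, OnPhaseSpace (s t) := by
  have hr := unit_orthogonal_of_hasDerivWithinAt (fun t ht => (hs t ht).state_qr)
    (fun t ht => (hs t ht).state_wr) (fun t => by
      change inner ℝ (State.qr (s t)) ((1 / P.Ir) • hat (State.qr (s t)) _) = 0
      rw [inner_smul_right, inner_hat_left, mul_zero]) h0.unit_qr h0.orth_wr
  have hc := fun j => unit_orthogonal_of_hasDerivWithinAt (fun t ht => (hs t ht).state_q j)
    (fun t ht => (hs t ht).state_w j) (fun t => by
      change inner ℝ (State.q (s t) j) ((1 / (P.mQ * P.Lc)) •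
        (P.mQ • hat (State.q (s t) j) _ - hat (State.q (s t) j) _)) = 0
      rw [inner_smul_right, inner_sub_right, inner_smul_right, inner_hat_left, inner_hat_left,
        mul_zero, sub_zero, mul_zero]) (h0.unit_q j) (h0.orth_w j)
  exact fun t ht => ⟨(hr t ht).1, (hr t ht).2, fun j => (hc j t ht).1, fun j => (hc j t ht).2⟩

end PhaseSpace

/-! ### Decay near the reference and trapping in sublevel sets. -/

section Trapping

open Set Filter Topology

/-- A differential inequality implies exponential decay. -/
theorem le_mul_exp_of_hasDerivWithinAt {f : ℝ → ℝ} {a b rate : ℝ} (hab : a ≤ b)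
    (h : ∀ t ∈ Icc a b, ∃ f', HasDerivWithinAt f f' (Icc a b) t ∧ f' ≤ -rate * f t) :
    f b ≤ f a * Real.exp (-rate * (b - a)) := by
  choose! f' hf hle using h
  have hg : ∀ t ∈ Icc a b, HasDerivWithinAt (fun t => f t * Real.exp (rate * (t - a)))
      (f' t * Real.exp (rate * (t - a)) + f t * (Real.exp (rate * (t - a)) * rate)) (Icc a b) t := by
    intro t ht
    have h1 : HasDerivAt (fun t : ℝ => rate * (t - a)) rate t := by
      simpa using ((hasDerivAt_id t).sub_const a).const_mul rate
    exact (hf t ht).mul h1.exp.hasDerivWithinAt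
  have hanti : AntitoneOn (fun t => f t * Real.exp (rate * (t - a))) (Icc a b) := by
    refine antitoneOn_of_hasDerivWithinAt_nonpos (convex_Icc a b)
      (fun t ht => (hg t ht).continuousWithinAt)
      (fun t ht => (hg t (interior_subset ht)).mono interior_subset) fun t ht => ?_
    have h1 := hle t (interior_subset ht)
    have h2 := Real.exp_pos (rate * (t - a))
    nlinarith
  have h1 := hanti (left_mem_Icc.2 hab) (right_mem_Icc.2 hab) hab
  simp only [sub_self, mul_zero, Real.exp_zero, mul_one] at h1
  rw [neg_mul, Real.exp_neg, ← div_eq_mul_inv, le_div_iff₀ (Real.exp_pos _)]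
  exact h1

variable {sigma : ℝ} {P : Params} {R : Reference} {B r c M B₁ : ℝ}

/-- The rate combines `lyap' ≤ -errNorm² / 4` with `lyap ≤ lyapUpper * errNorm²`. -/
theorem lyap_le_of_near (hL : LocalBounds sigma P R B r c M B₁) (hR : R.Admissible P)
    (hsigma : |sigma| = 1) {s : ℝ → State} {t₀ τ : ℝ} (ht₀ : 0 ≤ t₀) (hτ : t₀ ≤ τ)
    (hs : IsSolutionOn sigma P R (gains B B₁) s (Icc t₀ τ))
    (hn : ∀ t ∈ Icc t₀ τ, NearReference R r t (s t))
    (ha : ∀ t ∈ Icc t₀ τ, CablesAligned sigma P R (gains B B₁) t (s t)) :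
    lyap sigma P R B M B₁ τ (s τ) ≤ lyap sigma P R B M B₁ t₀ (s t₀) *
      Real.exp (-(1 / (4 * lyapUpper P B M B₁)) * (τ - t₀)) := by
  have hC := four_le_lyapUpper hL
  refine le_mul_exp_of_hasDerivWithinAt (f := fun t => lyap sigma P R B M B₁ t (s t)) hτ
    fun t ht => ?_
  have ht0 : 0 ≤ t := ht₀.trans ht.1
  obtain ⟨v', h1, h2⟩ := hasDerivWithinAt_lyap hL hR hsigma ht0 (hn t ht) (hs t ht)
  refine ⟨v', h1, h2.trans ?_⟩
  have h3 := lyap_le_errNorm_sq hL hR ht0 (hn t ht) (ha t ht)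
  rw [neg_mul, neg_mul, neg_le_neg_iff, one_div_mul_eq_div, div_le_iff₀ (by linarith)]
  linarith

theorem Psi_lt_of_near {t : ℝ} {s : State} (hR : R.Admissible P) (hs : NearReference R r t s)
    (hr : r ≤ 1) : Psi (R.q t) (State.qr s) < 1 := by
  have h1 := norm_sub_sq_eq_two_mul_Psi (hR.unit_q t) hs.phase.unit_qr
  have h2 := hs.q_le.trans hr
  nlinarith [norm_nonneg (State.qr s - R.q t)]

/-- Solutions that start in a small sublevel set of the Lyapunov function stay near the
reference. -/
theorem near_of_lyap_lt (hL : LocalBounds sigma P R B r c M B₁) (hR : R.Admissible P)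
    (hsigma : |sigma| = 1) {s : ℝ → State} {t₀ T : ℝ} (ht₀ : 0 ≤ t₀)
    (hs : IsSolutionOn sigma P R (gains B B₁) s (Ico t₀ T))
    (hn : NearReference R r t₀ (s t₀)) (ha : CablesAligned sigma P R (gains B B₁) t₀ (s t₀))
    (hW : lyap sigma P R B M B₁ t₀ (s t₀) < r ^ 2 / 4) :
    ∀ t ∈ Ico t₀ T, NearReference R r t (s t) ∧ CablesAligned sigma P R (gains B B₁) t (s t) := by
  have hr := hL.r_pos
  have hphase := onPhaseSpace_of_isSolutionOn hs hn.phase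
  have hcont : ∀ t ∈ Ico t₀ T, ContinuousWithinAt (fun t => (t, s t)) (Ico t₀ T) t := fun t ht =>
    continuousWithinAt_id.prodMk (hs t ht).continuousWithinAt
  have hex : ∀ t ∈ Ico t₀ T, ContinuousWithinAt (fun t => ‖ex R t (s t)‖) (Ico t₀ T) t :=
    fun t ht => ((contDiff_ex hR).continuous.continuousAt.comp_continuousWithinAt
      (hcont t ht)).norm
  have hev : ∀ t ∈ Ico t₀ T, ContinuousWithinAt (fun t => ‖ev R t (s t)‖) (Ico t₀ T) t :=
    fun t ht => ((contDiff_ev hR).continuous.continuousAt.comp_continuousWithinAt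
      (hcont t ht)).norm
  have hew : ∀ t ∈ Ico t₀ T, ContinuousWithinAt (fun t => ‖ewr R t (s t)‖) (Ico t₀ T) t :=
    fun t ht => ((contDiff_ewr hR).continuous.continuousAt.comp_continuousWithinAt
      (hcont t ht)).norm
  have heq : ∀ t ∈ Ico t₀ T,
      ContinuousWithinAt (fun t => ‖State.qr (s t) - R.q t‖) (Ico t₀ T) t := fun t ht =>
    ((hs t ht).state_qr.continuousWithinAt.sub
      hR.smooth_q.continuous.continuousWithinAt).norm
  have hPsi : ∀ t ∈ Ico t₀ T, NearReference R r t (s t) → ∀ j, ContinuousWithinAt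
      (fun t => Psi (qDes sigma P R (gains B B₁) j t (s t)) (State.q (s t) j)) (Ico t₀ T) t := by
    intro t ht hnt j
    have h0 : muDes sigma P R (gains B B₁) j t (s t) ≠ 0 :=
      norm_pos_iff.1 (hL.c_pos.trans_le (hL.le_muDes t _ (ht₀.trans ht.1) hnt j))
    have h1 : ContinuousWithinAt (fun t => qDes sigma P R (gains B B₁) j t (s t)) (Ico t₀ T) t :=
      (contDiffAt_qDes (p := (t, s t)) hR h0).continuousAt.comp_continuousWithinAt
        (f := fun t => (t, s t)) (hcont t ht)
    exact continuousWithinAt_const.sub (h1.inner ((hs t ht).state_q j).continuousWithinAt)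
  refine forall_Ico_of_continuation ⟨hn, ha⟩ (fun τ hτ hlt => ?_) (fun τ hτ hle => ?_)
  · have hτT : τ ∈ Ico t₀ T := ⟨hτ.1.le, hτ.2⟩
    have hsub : Ico t₀ τ ⊆ Ico t₀ T := Ico_subset_Ico_right hτ.2.le
    have hcl : τ ∈ closure (Ico t₀ τ) := by
      rw [closure_Ico hτ.1.ne]; exact ⟨hτ.1.le, le_rfl⟩
    have hlim : ∀ {f : ℝ → ℝ} {k : ℝ}, ContinuousWithinAt f (Ico t₀ T) τ →
        (∀ t ∈ Ico t₀ τ, f t ≤ k) → f τ ≤ k := fun hf h =>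
      ContinuousWithinAt.closure_le hcl (hf.mono hsub) continuousWithinAt_const h
    -- Nearness comes first: it makes the desired forces nonzero at `τ`, without which `qDes` need
    -- not be continuous there.
    have hnτ : NearReference R r τ (s τ) :=
      ⟨hphase τ hτT, hlim (hex τ hτT) fun t ht => (hlt t ht).1.ex_le,
        hlim (hev τ hτT) fun t ht => (hlt t ht).1.ev_le,
        hlim (heq τ hτT) fun t ht => (hlt t ht).1.q_le,
        hlim (hew τ hτT) fun t ht => (hlt t ht).1.ewr_le⟩
    exact ⟨hnτ, fun j => hlim (hPsi τ hτT hnτ j) fun t ht => (hlt t ht).2 j⟩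
  · have hnτ := (hle τ ⟨hτ.1, le_rfl⟩).1
    have hτ0 : 0 ≤ τ := ht₀.trans hτ.1
    have hsub : Icc t₀ τ ⊆ Ico t₀ T := fun t ht => ⟨ht.1, ht.2.trans_lt hτ.2⟩
    have hdec := lyap_le_of_near hL hR hsigma ht₀ hτ.1
      (fun t ht => (hs t (hsub ht)).mono hsub) (fun t ht => (hle t ht).1)
      (fun t ht => (hle t ht).2)
    have hC := four_le_lyapUpper hL
    have hpos : 0 ≤ lyap sigma P R B M B₁ t₀ (s t₀) := by
      nlinarith [errNorm_sq_le_lyap hL hR ht₀ hn,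
        sq_nonneg (errNorm sigma P R (gains B B₁) t₀ (s t₀))]
    have hexp : Real.exp (-(1 / (4 * lyapUpper P B M B₁)) * (τ - t₀)) ≤ 1 := by
      rw [Real.exp_le_one_iff, neg_mul, neg_nonpos]
      have : 0 ≤ τ - t₀ := sub_nonneg.2 hτ.1
      positivity
    -- The decay keeps this bound strict, so all the inequalities defining nearness and alignment
    -- become strict at `τ` and persist for a short time.
    have hWτ : lyap sigma P R B M B₁ τ (s τ) < r ^ 2 / 4 :=
      (hdec.trans (mul_le_of_le_one_right hpos hexp)).trans_lt hW
    have hlow := le_lyap hL hR hτ0 hnτ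
    have h0 : ∀ j, muDes sigma P R (gains B B₁) j τ (s τ) ≠ 0 := fun j =>
      norm_pos_iff.1 (hL.c_pos.trans_le (hL.le_muDes τ _ hτ0 hnτ j))
    have hP := fun j => Psi_nonneg (norm_qDes (h0 j)) (hnτ.phase.unit_q j)
    have hPr := Psi_nonneg (hR.unit_q τ) hnτ.phase.unit_qr
    have hqP := norm_sub_sq_eq_two_mul_Psi (hR.unit_q τ) hnτ.phase.unit_qr
    have hP0 := hP 0
    have hP1 := hP 1
    have hr1 := hL.r_le_one
    have n1 := sq_nonneg ‖ev R τ (s τ)‖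
    have n2 := sq_nonneg ‖ex R τ (s τ)‖
    have n3 := sq_nonneg ‖ewr R τ (s τ)‖
    have n4 := sq_nonneg ‖ewj sigma P R (gains B B₁) 0 τ (s τ)‖
    have n5 := sq_nonneg ‖ewj sigma P R (gains B B₁) 1 τ (s τ)‖
    have a1 : ‖ex R τ (s τ)‖ < r := lt_of_pow_lt_pow_left₀ 2 hr.le (by linarith)
    have a2 : ‖ev R τ (s τ)‖ < r := lt_of_pow_lt_pow_left₀ 2 hr.le (by linarith)
    have a3 : ‖State.qr (s τ) - R.q τ‖ < r := lt_of_pow_lt_pow_left₀ 2 hr.le (by linarith)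
    have a4 : ‖ewr R τ (s τ)‖ < r := lt_of_pow_lt_pow_left₀ 2 hr.le (by linarith)
    have hr2 : r ^ 2 ≤ 1 := by nlinarith
    have a5 : ∀ j, Psi (qDes sigma P R (gains B B₁) j τ (s τ)) (State.q (s τ) j) < 1 / 2 := by
      rw [Fin.forall_fin_two]
      constructor <;> linarith
    have hnhds : 𝓝[>] τ ≤ 𝓝[Ico t₀ T] τ := by
      refine nhdsWithin_le_iff.2 (mem_of_superset (Ioo_mem_nhdsGT hτ.2) ?_)
      exact fun t ht => ⟨hτ.1.trans ht.1.le, ht.2⟩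
    have ev1 := hnhds ((hex τ hτ).eventually_lt_const a1)
    have ev2 := hnhds ((hev τ hτ).eventually_lt_const a2)
    have ev3 := hnhds ((heq τ hτ).eventually_lt_const a3)
    have ev4 := hnhds ((hew τ hτ).eventually_lt_const a4)
    have ev5 := hnhds (eventually_all.2 fun j =>
      (hPsi τ hτ hnτ j).eventually_lt_const (a5 j))
    have ev6 : ∀ᶠ t in 𝓝[>] τ, t ∈ Ico t₀ T := hnhds self_mem_nhdsWithin
    filter_upwards [ev1, ev2, ev3, ev4, ev5, ev6] with t h1 h2 h3 h4 h5 h6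
    exact ⟨⟨hphase t h6, h1.le, h2.le, h3.le, h4.le⟩, fun j => (h5 j).le⟩

end Trapping

/-! ### Global existence, the exponential estimate and the domain of attraction. -/

section Stability

open Set Filter Topology

variable {sigma : ℝ} {P : Params} {R : Reference} {B r c M B₁ : ℝ}

theorem lyap_nonneg (hL : LocalBounds sigma P R B r c M B₁) (hR : R.Admissible P) {t : ℝ}
    {s : State} (ht : 0 ≤ t) (hs : NearReference R r t s) : 0 ≤ lyap sigma P R B M B₁ t s := by
  have h1 := errNorm_sq_le_lyap hL hR ht hs
  have h2 := sq_nonneg (errNorm sigma P R (gains B B₁) t s)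
  linarith

/-- The Lyapunov function decays exponentially along solutions that start in a small sublevel
set. -/
theorem lyap_le_mul_exp (hL : LocalBounds sigma P R B r c M B₁) (hR : R.Admissible P)
    (hsigma : |sigma| = 1) {s : ℝ → State} {t₀ T : ℝ} (ht₀ : 0 ≤ t₀)
    (hs : IsSolutionOn sigma P R (gains B B₁) s (Ico t₀ T))
    (hn : NearReference R r t₀ (s t₀)) (ha : CablesAligned sigma P R (gains B B₁) t₀ (s t₀))
    (hW : lyap sigma P R B M B₁ t₀ (s t₀) < r ^ 2 / 4) {t : ℝ} (ht : t ∈ Ico t₀ T) :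
    lyap sigma P R B M B₁ t (s t) ≤ lyap sigma P R B M B₁ t₀ (s t₀) *
      Real.exp (-(1 / (4 * lyapUpper P B M B₁)) * (t - t₀)) := by
  have hnear := near_of_lyap_lt hL hR hsigma ht₀ hs hn ha hW
  have hsub : Icc t₀ t ⊆ Ico t₀ T := fun τ hτ => ⟨hτ.1, hτ.2.trans_lt ht.2⟩
  exact lyap_le_of_near hL hR hsigma ht₀ ht.1 (fun τ hτ => (hs τ (hsub hτ)).mono hsub)
    (fun τ hτ => (hnear τ (hsub hτ)).1) (fun τ hτ => (hnear τ (hsub hτ)).2)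

/-- `NearReference` says nothing about the size of `ω_j`; compactness of the tube needs this extra
bound, which comes from `‖e_{ω_j}‖² ≤ 4 lyap < r² ≤ 1`. -/
theorem norm_w_le (hL : LocalBounds sigma P R B r c M B₁) (hR : R.Admissible P) {t : ℝ}
    {s : State} (ht : 0 ≤ t) (hs : NearReference R r t s)
    (hW : lyap sigma P R B M B₁ t s < r ^ 2 / 4) (j : Fin 2) : ‖State.w s j‖ ≤ 1 + B₁ := by
  have h1 := errNorm_sq_le_lyap hL hR ht hs
  have h2 : ∀ j, ‖ewj sigma P R (gains B B₁) j t s‖ ^ 2 ≤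
      errNorm sigma P R (gains B B₁) t s ^ 2 := by
    rw [Fin.forall_fin_two, errNorm_sq]
    constructor <;> linarith [sq_nonneg ‖ex R t s‖, sq_nonneg ‖ev R t s‖, sq_nonneg ‖eqr R t s‖,
      sq_nonneg ‖ewr R t s‖, sq_nonneg ‖eqj sigma P R (gains B B₁) 0 t s‖,
      sq_nonneg ‖ewj sigma P R (gains B B₁) 0 t s‖, sq_nonneg ‖eqj sigma P R (gains B B₁) 1 t s‖,
      sq_nonneg ‖ewj sigma P R (gains B B₁) 1 t s‖]
  have hr := hL.r_pos
  have hr1 := hL.r_le_one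
  have h3 : ‖ewj sigma P R (gains B B₁) j t s‖ ≤ 1 :=
    pow_le_one_iff_of_nonneg (norm_nonneg _) two_ne_zero |>.1 (by nlinarith [h2 j])
  have h4 := hL.wDes_le t s ht hs j
  have h5 := norm_le_norm_angErr_add (w := State.w s j)
    (z := wDes sigma P R (gains B B₁) j t s) (hs.phase.unit_q j)
  rw [ewj] at h3
  linarith

/-- States near the reference at times in `[t₀, T]`, with bounded cable velocities. -/
def tube (R : Reference) (r ρ t₀ T : ℝ) : Set (ℝ × State) :=
  {p | p.1 ∈ Icc t₀ T ∧ NearReference R r p.1 p.2 ∧ ∀ j, ‖State.w p.2 j‖ ≤ ρ}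

theorem isClosed_tube (hR : R.Admissible P) (ρ t₀ T : ℝ) : IsClosed (tube R r ρ t₀ T) := by
  have c1 := (contDiff_ex hR).continuous
  have c2 := (contDiff_ev hR).continuous
  have c3 := (contDiff_ewr hR).continuous
  have c4 : Continuous fun p : ℝ × State => State.qr p.2 :=
    State.contDiff_qr.continuous.comp continuous_snd
  have c5 : Continuous fun p : ℝ × State => State.wr p.2 :=
    State.contDiff_wr.continuous.comp continuous_snd
  have c6 : Continuous fun p : ℝ × State => R.q p.1 :=
    hR.smooth_q.continuous.comp continuous_fst
  have c7 : ∀ j, Continuous fun p : ℝ × State => State.q p.2 j := fun j =>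
    (State.contDiff_q j).continuous.comp continuous_snd
  have c8 : ∀ j, Continuous fun p : ℝ × State => State.w p.2 j := fun j =>
    (State.contDiff_w j).continuous.comp continuous_snd
  have heq : tube R r ρ t₀ T = {p : ℝ × State | p.1 ∈ Icc t₀ T} ∩ ({p | ‖State.qr p.2‖ = 1} ∩
      {p | inner ℝ (State.qr p.2) (State.wr p.2) = 0} ∩ {p | ∀ j, ‖State.q p.2 j‖ = 1} ∩
      {p | ∀ j, inner ℝ (State.q p.2 j) (State.w p.2 j) = 0} ∩ {p | ‖ex R p.1 p.2‖ ≤ r} ∩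
      {p | ‖ev R p.1 p.2‖ ≤ r} ∩ {p | ‖State.qr p.2 - R.q p.1‖ ≤ r} ∩ {p | ‖ewr R p.1 p.2‖ ≤ r}) ∩
      {p | ∀ j, ‖State.w p.2 j‖ ≤ ρ} := by
    ext p
    constructor
    · rintro ⟨h1, ⟨⟨a, b, c, d⟩, e, f, g, h⟩, h3⟩
      exact ⟨⟨h1, ⟨⟨⟨⟨⟨⟨⟨a, b⟩, c⟩, d⟩, e⟩, f⟩, g⟩, h⟩⟩, h3⟩
    · rintro ⟨⟨h1, ⟨⟨⟨⟨⟨⟨⟨a, b⟩, c⟩, d⟩, e⟩, f⟩, g⟩, h⟩⟩, h3⟩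
      exact ⟨h1, ⟨⟨a, b, c, d⟩, e, f, g, h⟩, h3⟩
  rw [heq]
  refine ((isClosed_Icc.preimage continuous_fst).inter ?_).inter ?_
  · refine (((((((isClosed_eq c4.norm continuous_const).inter
      (isClosed_eq (c4.inner c5) continuous_const)).inter ?_).inter ?_).inter
      (isClosed_le c1.norm continuous_const)).inter (isClosed_le c2.norm continuous_const)).inter
      (isClosed_le (c4.sub c6).norm continuous_const)).inter (isClosed_le c3.norm continuous_const)
    · rw [Set.ofPred_forall]
      exact isClosed_iInter fun j => isClosed_eq (c7 j).norm continuous_const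
    · rw [Set.ofPred_forall]
      exact isClosed_iInter fun j => isClosed_eq ((c7 j).inner (c8 j)) continuous_const
  · rw [Set.ofPred_forall]
    exact isClosed_iInter fun j => isClosed_le (c8 j).norm continuous_const

theorem isCompact_tube (hR : R.Admissible P) (hB : R.BoundedBy B) (hr : r ≤ 1) {ρ t₀ : ℝ}
    (ht₀ : 0 ≤ t₀) (T : ℝ) : IsCompact (tube R r ρ t₀ T) := by
  obtain ⟨X, hX⟩ := isCompact_Icc.exists_bound_of_continuousOn (s := Icc t₀ T)
    hR.smooth_x.continuous.continuousOn
  obtain ⟨Y, hY⟩ := isCompact_Icc.exists_bound_of_continuousOn (s := Icc t₀ T)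
    hR.contDiff_v.continuous.continuousOn
  set L := max (max (1 + X) (1 + Y)) (max (B + 1) (max 1 ρ))
  have hcomp : IsCompact (Icc t₀ T ×ˢ Metric.closedBall (0 : State) L) :=
    isCompact_Icc.prod (isCompact_closedBall _ _)
  refine hcomp.of_isClosed_subset (isClosed_tube hR ρ t₀ T) ?_
  rintro ⟨t, s⟩ ⟨ht, hs, hw⟩
  refine ⟨ht, mem_closedBall_zero_iff.2 ?_⟩
  have L1 : 1 + X ≤ L := (le_max_left _ _).trans (le_max_left _ _)
  have L2 : 1 + Y ≤ L := (le_max_right _ _).trans (le_max_left _ _)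
  have L3 : B + 1 ≤ L := (le_max_left _ _).trans (le_max_right _ _)
  have L4 : 1 ≤ L := ((le_max_left _ _).trans (le_max_right _ _)).trans (le_max_right _ _)
  have L5 : ρ ≤ L := ((le_max_right _ _).trans (le_max_right _ _)).trans (le_max_right _ _)
  have hx : ‖State.xr s‖ ≤ L := by
    have h1 := norm_sub_norm_le (State.xr s) (R.x t)
    have h2 := hs.ex_le
    have h3 := hX t ht
    rw [ex] at h2
    linarith
  have hv : ‖State.vr s‖ ≤ L := by
    have h1 := norm_sub_norm_le (State.vr s) (R.v t)
    have h2 := hs.ev_le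
    have h3 := hY t ht
    rw [ev] at h2
    linarith
  have hq : ‖State.qr s‖ ≤ L := hs.phase.unit_qr.trans_le L4
  have hwr : ‖State.wr s‖ ≤ L := (hs.norm_wr_le hB hr (ht₀.trans ht.1)).trans L3
  exact norm_prod_le_iff.2 ⟨norm_prod_le_iff.2 ⟨hx, norm_prod_le_iff.2 ⟨hv,
    norm_prod_le_iff.2 ⟨hq, hwr⟩⟩⟩, (pi_norm_le_iff_of_nonneg (zero_le_one.trans L4)).2 fun j =>
    norm_prod_le_iff.2 ⟨(hs.phase.unit_q j).trans_le L4, (hw j).trans L5⟩⟩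

/-- Global existence for initial states in a small sublevel set of the Lyapunov function. -/
theorem exists_isSolutionOn_Ici (hL : LocalBounds sigma P R B r c M B₁) (hR : R.Admissible P)
    (hsigma : |sigma| = 1) {t₀ : ℝ} (ht₀ : 0 ≤ t₀) {s₀ : State} (hn : NearReference R r t₀ s₀)
    (ha : CablesAligned sigma P R (gains B B₁) t₀ s₀)
    (hW : lyap sigma P R B M B₁ t₀ s₀ < r ^ 2 / 4) :
    ∃ s : ℝ → State, s t₀ = s₀ ∧ IsSolutionOn sigma P R (gains B B₁) s (Ici t₀) := by
  -- The closed-loop field is smooth where both desired forces are nonzero, and the tubes lie in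
  -- this open set.
  set U : Set (ℝ × State) := {p | ∀ j, muDes sigma P R (gains B B₁) j p.1 p.2 ≠ 0} with hU
  have hUo : IsOpen U := by
    rw [hU, Set.ofPred_forall]
    exact isOpen_iInter_of_finite fun j =>
      isOpen_ne_fun (contDiff_muDes hR j).continuous continuous_const
  have hsm : ContDiffOn ℝ 1 (fun p : ℝ × State => closedLoop sigma P R (gains B B₁) p.1 p.2) U :=
    fun p hp => ((contDiffAt_closedLoop hR hp).of_le (by exact_mod_cast le_top)).contDiffWithinAt
  refine exists_solution_Ici_of_mem_compact hUo hsm (K := fun T => tube R r (1 + B₁) t₀ T)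
    (fun T => isCompact_tube hR hL.ref hL.r_le_one ht₀ T) (fun T p hp j => ?_) (fun T hT => ?_)
    (fun T τ hτ s hs0 hs t ht => ?_)
  · exact norm_pos_iff.1
      (hL.c_pos.trans_le (hL.le_muDes p.1 p.2 (ht₀.trans hp.1.1) hp.2.1 j))
  · exact ⟨⟨le_rfl, hT⟩, hn, norm_w_le hL hR ht₀ hn hW⟩
  · rw [← hs0] at hn ha hW
    have ht0 : 0 ≤ t := ht₀.trans ht.1
    have hnt := (near_of_lyap_lt hL hR hsigma ht₀ hs hn ha hW t ht).1
    have hdec := lyap_le_mul_exp hL hR hsigma ht₀ hs hn ha hW ht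
    have hC := four_le_lyapUpper hL
    have hexp : Real.exp (-(1 / (4 * lyapUpper P B M B₁)) * (t - t₀)) ≤ 1 := by
      rw [Real.exp_le_one_iff, neg_mul, neg_nonpos]
      have : 0 ≤ t - t₀ := sub_nonneg.2 ht.1
      positivity
    exact ⟨⟨ht.1, ht.2.le.trans hτ⟩, hnt, norm_w_le hL hR ht0 hnt
      ((hdec.trans (mul_le_of_le_one_right (lyap_nonneg hL hR ht₀ hn) hexp)).trans_lt hW)⟩

/-- The error estimate for solutions that start in a small sublevel set. -/
theorem errNorm_le_mul_exp (hL : LocalBounds sigma P R B r c M B₁) (hR : R.Admissible P)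
    (hsigma : |sigma| = 1) {s : ℝ → State} {t₀ T : ℝ} (ht₀ : 0 ≤ t₀)
    (hs : IsSolutionOn sigma P R (gains B B₁) s (Ico t₀ T))
    (hn : NearReference R r t₀ (s t₀)) (ha : CablesAligned sigma P R (gains B B₁) t₀ (s t₀))
    (hW : lyap sigma P R B M B₁ t₀ (s t₀) < r ^ 2 / 4) {t : ℝ} (ht : t ∈ Ico t₀ T) :
    errNorm sigma P R (gains B B₁) t (s t) ≤ 2 * √(lyapUpper P B M B₁) *
      errNorm sigma P R (gains B B₁) t₀ (s t₀) *
      Real.exp (-(1 / (8 * lyapUpper P B M B₁)) * (t - t₀)) := by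
  have hC := four_le_lyapUpper hL
  have hnt := (near_of_lyap_lt hL hR hsigma ht₀ hs hn ha hW t ht).1
  have h1 := lyap_le_mul_exp hL hR hsigma ht₀ hs hn ha hW ht
  have h2 := errNorm_sq_le_lyap hL hR (ht₀.trans ht.1) hnt
  have h3 := lyap_le_errNorm_sq hL hR ht₀ hn ha
  set Q := lyapUpper P B M B₁
  -- Passing from `lyap` to the norm takes a square root, which halves the rate.
  have hexp : Real.exp (-(1 / (4 * Q)) * (t - t₀)) =
      Real.exp (-(1 / (8 * Q)) * (t - t₀)) ^ 2 := by
    rw [← Real.exp_nat_mul]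
    congr 1
    push_cast
    have : Q ≠ 0 := by linarith
    field_simp
    ring
  set e := Real.exp (-(1 / (8 * Q)) * (t - t₀)) with he
  have he0 : 0 < e := Real.exp_pos _
  have hE0 : 0 ≤ errNorm sigma P R (gains B B₁) t₀ (s t₀) := Real.sqrt_nonneg _
  refine le_of_sq_le_sq ?_ (by positivity)
  rw [hexp] at h1
  have h4 := mul_le_mul_of_nonneg_right h3 (sq_nonneg e)
  calc errNorm sigma P R (gains B B₁) t (s t) ^ 2
      ≤ 4 * (Q * errNorm sigma P R (gains B B₁) t₀ (s t₀) ^ 2 * e ^ 2) := by linarith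
    _ = (2 * √Q * errNorm sigma P R (gains B B₁) t₀ (s t₀) * e) ^ 2 := by
      rw [mul_pow, mul_pow, mul_pow, Real.sq_sqrt (by linarith)]
      ring

/-- Initial states in the domain are near the reference, in a small sublevel set. -/
theorem InDomain.near_and_lyap_lt (hL : LocalBounds sigma P R B r c M B₁) (hR : R.Admissible P)
    {psi : Fin 2 → ℝ} {delta a t : ℝ} {s : State} (ht : 0 ≤ t) (hd0 : 0 < delta)
    (hd : delta * (7 + stiffness B (2 * B * (B + 1)) + 2 * cableWeight P M) ≤ r ^ 2 / 16)
    (ha : cableWeight P M * (stiffness B₁ 0 + 2) * a ≤ r ^ 2 / 32) (hpsi : ∀ j, psi j ≤ a)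
    (hs : InDomain sigma P R (gains B B₁) psi delta t s) :
    NearReference R r t s ∧ lyap sigma P R B M B₁ t s < r ^ 2 / 4 := by
  have hB := hL.ref.nonneg
  have hr := hL.r_pos
  have hr1 := hL.r_le_one
  have hN := one_le_cableWeight P M
  have hk := three_le_stiffness (B := B) (show 0 ≤ 2 * B * (B + 1) by positivity)
  have hk₁ := three_le_stiffness (B := B₁) (b := 0) le_rfl
  have hexp := lyap_le_explicit (sigma := sigma) (P := P) (R := R) (B := B) (M := M) (B₁ := B₁) t s
  set k := stiffness B (2 * B * (B + 1))
  set k₁ := stiffness B₁ 0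
  set N := cableWeight P M
  -- The bracket in `hd` is at least `7 + 3 + 2`.
  have hd1 : 12 * delta ≤ r ^ 2 / 16 := by
    nlinarith
  have hr2 : r ^ 2 ≤ r := by nlinarith
  have hdr : delta ≤ r := by linarith
  have hdone : delta ≤ 1 := hdr.trans hr1
  have hdsq : delta ^ 2 ≤ delta := by nlinarith
  have hqr := norm_sub_sq_eq_two_mul_Psi (hR.unit_q t) hs.phase.unit_qr
  have hP := hs.Psi_r_le
  have hnear : NearReference R r t s :=
    ⟨hs.phase, hs.ex_le.trans hdr, hs.ev_le.trans hdr, le_of_sq_le_sq (by linarith) hr.le,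
      hs.ewr_le.trans hdr⟩
  refine ⟨hnear, ?_⟩
  have sq : ∀ {x : ℝ}, 0 ≤ x → x ≤ delta → x ^ 2 ≤ delta := fun h0 h =>
    (pow_le_pow_left₀ h0 h 2).trans hdsq
  have b1 := sq (norm_nonneg _) hs.ex_le
  have b2 := sq (norm_nonneg _) hs.ev_le
  have b3 := sq (norm_nonneg _) hs.ewr_le
  have b4 : ‖eqr R t s‖ ^ 2 ≤ 2 * delta :=
    (norm_attErr_sq_le (hR.unit_q t) hs.phase.unit_qr).trans (by linarith)
  have b5 : k * Psi (R.q t) (State.qr s) ≤ k * delta := by gcongr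
  have hc : ∀ j, ‖ewj sigma P R (gains B B₁) j t s‖ ^ 2
      + k₁ * Psi (qDes sigma P R (gains B B₁) j t s) (State.q s j)
      + ‖eqj sigma P R (gains B B₁) j t s‖ ^ 2 ≤ delta + (k₁ + 2) * a := by
    intro j
    have h0 : muDes sigma P R (gains B B₁) j t s ≠ 0 :=
      norm_pos_iff.1 (hL.c_pos.trans_le (hL.le_muDes t _ ht hnear j))
    have c1 := sq (norm_nonneg _) (hs.ew_le j)
    have c2 := (hs.Psi_le j).trans (hpsi j)
    have c3 : ‖eqj sigma P R (gains B B₁) j t s‖ ^ 2 ≤ 2 * a :=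
      (norm_attErr_sq_le (norm_qDes h0) (hs.phase.unit_q j)).trans (by linarith)
    have c4 := mul_le_mul_of_nonneg_left c2 (show 0 ≤ k₁ by linarith)
    linarith
  -- The explicit bound now sums to `δ (7 + k + 2 N) + 2 N (k₁ + 2) a`, at most `r² / 16 + r² / 16`.
  have b6 := mul_le_mul_of_nonneg_left (add_le_add (hc 0) (hc 1)) (show 0 ≤ N by linarith)
  have hrr : 0 < r ^ 2 := by positivity
  linarith

theorem gains_positive (hL : LocalBounds sigma P R B r c M B₁) : (gains B B₁).Positive := by
  have hB := hL.ref.nonneg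
  have hk := three_le_stiffness (B := B) (show 0 ≤ 2 * B * (B + 1) by positivity)
  have hk₁ := three_le_stiffness (B := B₁) (b := 0) le_rfl
  refine ⟨three_pos, two_pos, ?_, two_pos, fun j => ?_, fun j => two_pos⟩
  · rw [gains_kqr]; linarith
  · rw [gains_kq]; linarith

/-- For `ψ < 1` one has `ψ ≤ ψ (2 - ψ) = α_j²`, and `α_j ≤ α₀ / 2`. -/
theorem psi_le_of_alpha_le {psi : Fin 2 → ℝ} {α₀ : ℝ} (hpsi : ∀ j, 0 < psi j ∧ psi j < 1)
    (hα : alpha psi ≤ α₀) (j : Fin 2) : psi j ≤ α₀ ^ 2 / 4 := by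
  have h1 : √(psi j * (2 - psi j)) ≤ α₀ / 2 := by
    have h2 : √(psi j * (2 - psi j)) ≤
        max (√(psi 0 * (2 - psi 0))) (√(psi 1 * (2 - psi 1))) := by
      fin_cases j
      · exact le_max_left _ _
      · exact le_max_right _ _
    rw [alpha] at hα
    linarith
  obtain ⟨h0, h2⟩ := hpsi j
  have h3 : 0 ≤ psi j * (2 - psi j) := mul_nonneg h0.le (by linarith)
  have h4 := pow_le_pow_left₀ (Real.sqrt_nonneg _) h1 2
  rw [Real.sq_sqrt h3] at h4
  nlinarith

end Stability

end RodTransport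

/-! ### The stability theorem. -/

theorem theorem4p1 (P : RodTransport.Params) (R : RodTransport.Reference)
    (hR : R.Admissible P) (sigma : ℝ) (hsigma : sigma = 1 ∨ sigma = -1) :
    ∃ alpha₀ : ℝ, 0 < alpha₀ ∧
      ∀ psi : Fin 2 → ℝ, (∀ j, 0 < psi j ∧ psi j < 1) → RodTransport.alpha psi ≤ alpha₀ →
        ∃ K : RodTransport.Gains, K.Positive ∧
          RodTransport.ExponentiallyStable sigma P R K psi := by
  open RodTransport in
  have hs1 : |sigma| = 1 := by rcases hsigma with h | h <;> simp [h]
  obtain ⟨B, r, c, M, B₁, hL⟩ := exists_localBounds hR hs1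
  have hB := hL.ref.nonneg
  have hr := hL.r_pos
  have hr1 := hL.r_le_one
  have hN := one_le_cableWeight P M
  have hk := three_le_stiffness (B := B) (show 0 ≤ 2 * B * (B + 1) by positivity)
  have hk₁ := three_le_stiffness (B := B₁) (b := 0) le_rfl
  have hC := four_le_lyapUpper hL
  set D := cableWeight P M * (stiffness B₁ 0 + 2) with hD
  have hD1 : 1 ≤ D := one_le_mul_of_one_le_of_one_le hN (by linarith)
  set E := 7 + stiffness B (2 * B * (B + 1)) + 2 * cableWeight P M with hE
  have hE1 : 1 ≤ E := by linarith
  -- Every admitted `ψ_j` is at most `α₀ ^ 2 / 4`. Since `α₀ ≤ 1`, it suffices that `D * α₀ = r² /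
  -- 8` for the cable part of the initial energy to meet the bound `r² / 32` in `ha`.
  set α₀ := r ^ 2 / (8 * D) with hα₀
  have hα₀0 : 0 < α₀ := by positivity
  have hα₀D : D * α₀ = r ^ 2 / 8 := by rw [hα₀]; field_simp
  have hα₀1 : α₀ ≤ 1 := by nlinarith
  have ha : D * (α₀ ^ 2 / 4) ≤ r ^ 2 / 32 := by nlinarith
  refine ⟨α₀, hα₀0, fun psi hpsi hα => ⟨gains B B₁, gains_positive hL, r ^ 2 / (16 * E),
    by positivity, 2 * √(lyapUpper P B M B₁), by positivity, 1 / (8 * lyapUpper P B M B₁),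
    by positivity, fun t₀ ht₀ s₀ hdom => ?_⟩⟩
  have hpa := psi_le_of_alpha_le hpsi hα
  obtain ⟨hn, hW⟩ := hdom.near_and_lyap_lt hL hR ht₀ (by positivity)
    (le_of_eq (by rw [← hE]; field_simp)) ha hpa
  have hal : CablesAligned sigma P R (gains B B₁) t₀ s₀ := fun j =>
    ((hdom.Psi_le j).trans (hpa j)).trans (by nlinarith)
  refine ⟨exists_isSolutionOn_Ici hL hR hs1 ht₀ hn hal hW, fun T s hs0 hs t ht => ?_⟩
  rw [← hs0] at hn hal hW
  obtain ⟨hnt, hat⟩ := near_of_lyap_lt hL hR hs1 ht₀ hs hn hal hW t ht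
  refine ⟨?_, Psi_lt_of_near hR hnt hr1, fun j => (hat j).trans_lt (by norm_num)⟩
  rw [← hs0]
  exact errNorm_le_mul_exp hL hR hs1 ht₀ hs hn hal hW ht
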